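/- Let $(K,d)$ be a metric space in which sets of finite diameter are relatively compact, let $(V,E,i,t)$ be a finite directed multigraph with $V=\{1,\dots,N\}$ and $i:E\to V$ surjective, and let $\mathcal M=(K_{i(e)},w_e,p_e)_{e\in E}$ be a contractive Markov system on $K$: $K_1,\dots,K_N$ is a partition of $K$ into non-empty open sets; the maps $w_e:K\to K$ are Borel with $w_e(K_{i(e)})\subset K_{t(e)}$; the functions $p_e:K\to[0,\infty)$ are Borel with $\sum_{e\in E}p_e=1$ and $p_e=0$ off $K_{i(e)}$; and there is $0<a<1$ with $\sum_{e\in E}p_e(x)\,d(w_ex,w_ey)\le a\,d(x,y)$ for all $x,y\in K_j$, $j=1,\dots,N$. Assume that each $p_e|_{K_{i(e)}}$ is uniformly continuous and that $p_e|_{K_{i(e)}}\ge\delta$ for some $\delta>0$ independent of $e$. Let $\mu$ be an invariant Borel probability measure, i.e. $\int\sum_{e}p_e\,(f\circ w_e)\,d\mu=\int f\,d\mu$ for all bounded Borel $f:K\to\mathbb R$, and let $M$ be the associated generalized Markov measure, i.e. the Borel probability measure on $\Sigma=E^{\mathbb Z}$ with \[M\left(\{\sigma:\sigma_m=e_1,\dots,\sigma_{m+k-1}=e_k\}\right)=\int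 p_{e_1}(x)\,p_{e_2}(w_{e_1}x)\cdots p_{e_k}(w_{e_{k-1}}\circ\cdots\circ w_{e_1}x)\,d\mu(x)\] for all $m\in\mathbb Z$, $k\ge1$ and $e_1,\dots,e_k\in E$. Let $S$ be the left shift on $\Sigma$. Fix $x_j\in K_j$ for $j=1,\dots,N$. Let $D$ be the set of all $\sigma\in\Sigma$ with $t(\sigma_j)=i(\sigma_{j+1})$ for all $j\in\mathbb Z$ for which the limit $F(\sigma)=\lim_{m\to-\infty}w_{\sigma_0}\circ w_{\sigma_{-1}}\circ\cdots\circ w_{\sigma_m}x_{i(\sigma_m)}$ exists. Put $Y=\bigcap_{k\in\mathbb Z}S^k(D)$, and let $u(\sigma)=\log p_{\sigma_1}(F(\sigma))$ for $\sigma\in Y$ and $u(\sigma)=-\infty$ for $\sigma\in\Sigma\setminus Y$. Suppose that $\sum_{j=1}^N\int_{K_j}d(x,z_j)\,d\mu(x)<\infty$ for some $z_1,\dots,z_N\in K$, and that $M(Y)=1$. Then: (i) $M$ is an equilibrium state for $u$; that is, $u$ is a Borel function with values in $[-\infty,0]$, $\sup_\Theta h_\Theta(S)<\infty$, $M$ is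 $S$-invariant, and $h_M(S)+\int u\,dM=P(u)$, where $P(u)=\sup_\Theta\left(h_\Theta(S)+\int u\,d\Theta\right)$, both suprema are over all $S$-invariant Borel probability measures $\Theta$ on $\Sigma$, and $h_\Theta(S)$ is the Kolmogorov-Sinai entropy; (ii) $P(u)=0$. -/

import Mathlib

open MeasureTheory Filter Topology

set_option linter.unusedSectionVars false

noncomputable section

/-! ### Entropy, pressure, equilibrium states -/

section Thermodynamics

variable {X : Type*} [MeasurableSpace X]

/-- Shannon entropy of the join `⋁_{i<n} T⁻ⁱ P`, where the finite measurable partition `P` of `X`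
into (possibly empty) cells is given by its labelling map `P : X → Fin k`. -/
def joinEntropy (T : X → X) (Θ : Measure X) {k : ℕ} (P : X → Fin k) (n : ℕ) : ℝ :=
  ∑ c : Fin n → Fin k, Real.negMulLog (Θ.real {x | ∀ i : Fin n, P (T^[i] x) = c i})

/-- Entropy of `T` relative to a finite partition: `lim (1/n) H(⋁_{i<n} T⁻ⁱ P)`.
For invariant `Θ` the limit exists by subadditivity, so it is equal to the upper limit. -/
def partitionEntropy (T : X → X) (Θ : Measure X) {k : ℕ} (P : X → Fin k) : EReal :=
  limsup (fun n : ℕ => ((joinEntropy T Θ P n / n : ℝ) : EReal)) atTop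

/-- Kolmogorov-Sinai entropy: the supremum over all finite measurable partitions. -/
def ksEntropy (T : X → X) (Θ : Measure X) : EReal :=
  ⨆ (k : ℕ) (P : X → Fin k) (_ : Measurable P), partitionEntropy T Θ P

/-- Invariant probability measures of `T`. -/
def invariantMeasures (T : X → X) : Set (Measure X) :=
  {Θ | IsProbabilityMeasure Θ ∧ MeasurePreserving T Θ Θ}

/-- An energy function is a measurable function with values in `[-∞, 0]`. -/
structure IsEnergyFunction (f : X → EReal) : Prop where
  measurable : Measurable f
  nonpos : ∀ x, f x ≤ 0

/-- The integral `Θ(f) ∈ [-∞, 0]` of a function `f` with values in `[-∞, 0]`. -/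
def energyIntegral (Θ : Measure X) (f : X → EReal) : EReal :=
  -((∫⁻ x, (-f x).toENNReal ∂Θ : ENNReal) : EReal)

/-- `T` has finite topological entropy, in the variational form `sup_Θ h_Θ(T) < ∞`. -/
def HasFiniteEntropy (T : X → X) : Prop :=
  (⨆ Θ ∈ invariantMeasures T, ksEntropy T Θ) < ⊤

/-- The pressure `P(f) = sup_Θ (h_Θ(T) + Θ(f))` over the invariant probability measures. -/
def pressure (T : X → X) (f : X → EReal) : EReal :=
  ⨆ Θ ∈ invariantMeasures T, (ksEntropy T Θ + energyIntegral Θ f)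

/-- `Λ` is an equilibrium state for `f`. The first two fields are what the definition of the
pressure presupposes. -/
structure IsEquilibriumState (T : X → X) (f : X → EReal) (Λ : Measure X) : Prop where
  energy : IsEnergyFunction f
  finite_entropy : HasFiniteEntropy T
  invariant : Λ ∈ invariantMeasures T
  attains : ksEntropy T Λ + energyIntegral Λ f = pressure T f

end Thermodynamics

/-! ### Markov systems -/

/-- A Markov system on `K` over the finite directed multigraph with vertices `V`, edges `E`,
initial-vertex map `init` and terminal-vertex map `term`. -/
structure MarkovSystem (V E K : Type*) [Fintype E] [MeasurableSpace K] where
  init : E → V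
  term : E → V
  vertexSet : V → Set K
  w : E → K → K
  p : E → K → ℝ
  vertexSet_nonempty : ∀ v, (vertexSet v).Nonempty
  vertexSet_measurable : ∀ v, MeasurableSet (vertexSet v)
  vertexSet_disjoint : Pairwise fun v v' => Disjoint (vertexSet v) (vertexSet v')
  vertexSet_cover : ⋃ v, vertexSet v = Set.univ
  w_measurable : ∀ e, Measurable (w e)
  w_mapsTo : ∀ e, Set.MapsTo (w e) (vertexSet (init e)) (vertexSet (term e))
  p_measurable : ∀ e, Measurable (p e)
  p_nonneg : ∀ e x, 0 ≤ p e x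
  p_sum : ∀ x, ∑ e, p e x = 1
  p_zero : ∀ e, ∀ x ∉ vertexSet (init e), p e x = 0

/-- The code space `E^ℤ`, with the product topology and its Borel σ-algebra. -/
abbrev CodeSpace (E : Type*) := ℤ → E

/-- The left shift. -/
def leftShift {E : Type*} (σ : CodeSpace E) : CodeSpace E := fun j => σ (j + 1)

/-- The cylinder `ₘ[e₁, …, e_k] = {σ | σ_m = e₁, …, σ_{m+k-1} = e_k}`. -/
def cylinderSet {E : Type*} (m : ℤ) (l : List E) : Set (CodeSpace E) :=
  {σ | ∀ j : Fin l.length, σ (m + (j : ℕ)) = l.get j}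

namespace MarkovSystem

variable {V E K : Type*} [Fintype E] [MeasurableSpace K]

/-- Contractiveness on average with rate `a`. -/
def IsContractive [PseudoMetricSpace K] (S : MarkovSystem V E K) (a : ℝ) : Prop :=
  0 < a ∧ a < 1 ∧ ∀ v, ∀ x ∈ S.vertexSet v, ∀ y ∈ S.vertexSet v,
    ∑ e, S.p e x * dist (S.w e x) (S.w e y) ≤ a * dist x y

/-- The Markov operator `U f = ∑ₑ pₑ · (f ∘ wₑ)`. -/
def markovOp (S : MarkovSystem V E K) (f : K → ℝ) (x : K) : ℝ :=
  ∑ e, S.p e x * f (S.w e x)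

/-- Invariance `U* μ = μ`, tested on all bounded measurable functions. -/
def IsInvariant (S : MarkovSystem V E K) (μ : Measure K) : Prop :=
  ∀ f : K → ℝ, Measurable f → (∃ C, ∀ x, |f x| ≤ C) →
    ∫ x, S.markovOp f x ∂μ = ∫ x, f x ∂μ

/-- `p_{e₁}(x) p_{e₂}(w_{e₁} x) ⋯ p_{e_k}(w_{e_{k-1}} ∘ ⋯ ∘ w_{e₁} x)`. -/
def pathProb (S : MarkovSystem V E K) : List E → K → ℝ
  | [], _ => 1
  | e :: l, x => S.p e x * S.pathProb l (S.w e x)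

/-- `M` has the cylinder values that define the generalized Markov measure. -/
def HasMarkovCylinders [MeasurableSpace E] (S : MarkovSystem V E K) (μ : Measure K)
    (M : Measure (CodeSpace E)) : Prop :=
  ∀ (m : ℤ) (l : List E), M (cylinderSet m l) = ENNReal.ofReal (∫ x, S.pathProb l x ∂μ)

/-! Existence and uniqueness of the measure with these cylinder values. -/

lemma pathProb_measurable (S : MarkovSystem V E K) (l : List E) : Measurable (S.pathProb l) := by
  induction l with
  | nil => exact measurable_const
  | cons e l ih => exact (S.p_measurable e).mul (ih.comp (S.w_measurable e))

lemma p_le_one (S : MarkovSystem V E K) (e : E) (x : K) : S.p e x ≤ 1 := by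
  rw [← S.p_sum x]
  exact Finset.single_le_sum (fun i _ => S.p_nonneg i x) (Finset.mem_univ e)

lemma pathProb_mem (S : MarkovSystem V E K) (l : List E) (x : K) :
    0 ≤ S.pathProb l x ∧ S.pathProb l x ≤ 1 := by
  induction l generalizing x with
  | nil => simp [pathProb]
  | cons e l ih =>
    have h := ih (S.w e x)
    exact ⟨mul_nonneg (S.p_nonneg e x) h.1, mul_le_one₀ (S.p_le_one e x) h.1 h.2⟩

lemma pathProb_integrable (S : MarkovSystem V E K) (μ : Measure K) [IsProbabilityMeasure μ]
    (l : List E) : Integrable (S.pathProb l) μ :=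
  Integrable.of_bound (S.pathProb_measurable l).aestronglyMeasurable 1
    (Eventually.of_forall fun x => by
      rw [Real.norm_eq_abs, abs_of_nonneg (S.pathProb_mem l x).1]; exact (S.pathProb_mem l x).2)

lemma sum_pathProb_append (S : MarkovSystem V E K) (l : List E) (x : K) :
    ∑ e, S.pathProb (l ++ [e]) x = S.pathProb l x := by
  induction l generalizing x with
  | nil => simpa [pathProb] using S.p_sum x
  | cons e l ih => simp only [List.cons_append, pathProb, ← Finset.mul_sum, ih]

lemma sum_integral_append (S : MarkovSystem V E K) (μ : Measure K) [IsProbabilityMeasure μ]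
    (l : List E) : ∑ e, ∫ x, S.pathProb (l ++ [e]) x ∂μ = ∫ x, S.pathProb l x ∂μ := by
  rw [← integral_finsetSum _ fun e _ => S.pathProb_integrable μ _]
  simp only [sum_pathProb_append]

lemma sum_integral_cons (S : MarkovSystem V E K) (μ : Measure K) [IsProbabilityMeasure μ]
    (hμ : S.IsInvariant μ) (l : List E) :
    ∑ e, ∫ x, S.pathProb (e :: l) x ∂μ = ∫ x, S.pathProb l x ∂μ := by
  rw [← integral_finsetSum _ fun e _ => S.pathProb_integrable μ _]
  exact hμ _ (S.pathProb_measurable l) ⟨1, fun x => by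
    rw [abs_of_nonneg (S.pathProb_mem l x).1]; exact (S.pathProb_mem l x).2⟩

lemma cylinder_cons (m : ℤ) (e : E) (l : List E) :
    cylinderSet m (e :: l) = {σ : CodeSpace E | σ m = e} ∩ cylinderSet (m + 1) l := by
  ext σ
  simp only [cylinderSet, Set.mem_ofPred_eq, Set.mem_inter_iff]
  constructor
  · intro h
    refine ⟨by simpa using h ⟨0, by simp⟩, fun j => ?_⟩
    have := h ⟨j + 1, by simp⟩
    simp only [List.get_eq_getElem, List.getElem_cons_succ] at this ⊢
    rw [← this]; congr 1; push_cast; ring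
  · rintro ⟨h0, h⟩ ⟨j, hj⟩
    cases j with
    | zero => simpa using h0
    | succ j =>
      have := h ⟨j, by simpa using hj⟩
      simp only [List.get_eq_getElem, List.getElem_cons_succ] at this ⊢
      rw [← this]; congr 1; push_cast; ring

lemma cylinder_append (m : ℤ) (l : List E) (e : E) :
    cylinderSet m (l ++ [e]) = cylinderSet m l ∩ {σ : CodeSpace E | σ (m + l.length) = e} := by
  induction l generalizing m with
  | nil => simp [cylinderSet]
  | cons f l ih =>
    rw [List.cons_append, cylinder_cons, ih, cylinder_cons, Set.inter_assoc]
    congr 2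
    ext σ
    simp only [List.length_cons, Set.mem_ofPred_eq]
    rw [show m + ((l.length + 1 : ℕ) : ℤ) = m + 1 + l.length by push_cast; ring]

section Existence

variable [TopologicalSpace E] [DiscreteTopology E] [MeasurableSpace E] [BorelSpace E]

lemma cylinder_isClopen (m : ℤ) (l : List E) : IsClopen (cylinderSet m l) := by
  have : cylinderSet m l = ⋂ j : Fin l.length,
      (fun σ : CodeSpace E => σ (m + (j : ℕ))) ⁻¹' {l.get j} := by
    ext σ; simp [cylinderSet]
  rw [this]
  exact isClopen_iInter_of_finite fun j => (isClopen_discrete _).preimage (continuous_apply _)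

lemma measurableSet_coord (j : ℤ) (e : E) : MeasurableSet {σ : CodeSpace E | σ j = e} := by
  have h : MeasurableSet ((fun σ : CodeSpace E => σ j) ⁻¹' {e}) :=
    measurable_pi_apply j (measurableSet_singleton e)
  exact h

lemma measure_eq_sum_inter (M : Measure (CodeSpace E)) (A : Set (CodeSpace E))
    (hA : MeasurableSet A) (j : ℤ) : M A = ∑ e, M (A ∩ {σ | σ j = e}) := by
  rw [← measure_biUnion_finset]
  · congr 1; ext σ; simp
  · intro e _ e' _ hne
    refine Set.disjoint_left.2 fun σ h h' => hne ?_
    exact h.2.symm.trans h'.2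
  · exact fun e _ => hA.inter (measurableSet_coord j e)

lemma measure_cylinder_append (M : Measure (CodeSpace E)) (m : ℤ) (l : List E) :
    M (cylinderSet m l) = ∑ e, M (cylinderSet m (l ++ [e])) := by
  simp only [cylinder_append]
  exact measure_eq_sum_inter M _ (cylinder_isClopen m l).isOpen.measurableSet _

lemma measure_cylinder_cons (M : Measure (CodeSpace E)) (m : ℤ) (l : List E) :
    M (cylinderSet (m + 1) l) = ∑ e, M (cylinderSet m (e :: l)) := by
  simp only [cylinder_cons, Set.inter_comm _ (cylinderSet (m + 1) l)]
  exact measure_eq_sum_inter M _ (cylinder_isClopen _ l).isOpen.measurableSet _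

lemma hasCylinders_of_window (S : MarkovSystem V E K) (μ : Measure K) [IsProbabilityMeasure μ]
    (hμ : S.IsInvariant μ) (M : Measure (CodeSpace E)) (m : ℤ) (L : ℕ)
    (h : ∀ l : List E, l.length = L →
      M (cylinderSet m l) = ENNReal.ofReal (∫ x, S.pathProb l x ∂μ)) (i : ℕ) :
    ∀ (d : ℕ) (l : List E), i + l.length + d = L →
      M (cylinderSet (m + i) l) = ENNReal.ofReal (∫ x, S.pathProb l x ∂μ) := by
  have hnn : ∀ l : List E, 0 ≤ ∫ x, S.pathProb l x ∂μ := fun l =>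
    integral_nonneg fun x => (S.pathProb_mem l x).1
  induction i with
  | zero =>
    intro d
    induction d with
    | zero => intro l hl; simpa using h l (by simpa using hl)
    | succ d ih =>
      intro l hl
      rw [measure_cylinder_append, ← S.sum_integral_append μ l,
        ENNReal.ofReal_sum_of_nonneg fun e _ => hnn _]
      exact Finset.sum_congr rfl fun e _ => ih _ (by simp; omega)
  | succ i ih =>
    intro d l hl
    rw [show m + ((i + 1 : ℕ) : ℤ) = (m + i) + 1 by push_cast; ring, measure_cylinder_cons,
      ← S.sum_integral_cons μ hμ l, ENNReal.ofReal_sum_of_nonneg fun e _ => hnn _]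
    exact Finset.sum_congr rfl fun e _ => ih d _ (by simp; omega)

/-- A sequence that carries the word `c` in the window `[-n, n]`. -/
def padWord (n : ℕ) (c : Fin (2 * n + 1) → E) : CodeSpace E :=
  fun j => c ⟨(j + n).toNat % (2 * n + 1), Nat.mod_lt _ (by omega)⟩

lemma padWord_mem (n : ℕ) (c c' : Fin (2 * n + 1) → E) :
    padWord n c ∈ cylinderSet (-(n : ℤ)) (List.ofFn c') ↔ c = c' := by
  have key : ∀ j : Fin (2 * n + 1), padWord n c (-(n : ℤ) + (j : ℕ)) = c j := by
    intro j
    simp only [padWord]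
    congr 1
    ext
    simp only
    rw [show (-(n : ℤ) + (j : ℕ) + n) = ((j : ℕ) : ℤ) by ring, Int.toNat_natCast,
      Nat.mod_eq_of_lt j.2]
  constructor
  · intro h
    ext j
    have := h ⟨j, by rw [List.length_ofFn]; exact j.2⟩
    rw [key j, List.get_ofFn] at this
    exact this
  · rintro rfl ⟨j, hj⟩
    have hj' : j < 2 * n + 1 := by simpa using hj
    rw [List.get_ofFn]
    exact key ⟨j, hj'⟩

/-- A measure with the right values on the cylinders over the window `[-n, n]`. -/
def windowMeasure (S : MarkovSystem V E K) (μ : Measure K) (n : ℕ) : Measure (CodeSpace E) :=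
  ∑ c : Fin (2 * n + 1) → E,
    ENNReal.ofReal (∫ x, S.pathProb (List.ofFn c) x ∂μ) • Measure.dirac (padWord n c)

lemma windowMeasure_cylinder (S : MarkovSystem V E K) (μ : Measure K) (n : ℕ) (l : List E)
    (hl : l.length = 2 * n + 1) :
    S.windowMeasure μ n (cylinderSet (-(n : ℤ)) l)
      = ENNReal.ofReal (∫ x, S.pathProb l x ∂μ) := by
  classical
  obtain ⟨c, rfl⟩ : ∃ c : Fin (2 * n + 1) → E, l = List.ofFn c := by
    refine ⟨fun j => l.get (j.cast hl.symm), ?_⟩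
    refine List.ext_get (by rw [List.length_ofFn, hl]) fun j h1 h2 => ?_
    rw [List.get_ofFn]
    rfl
  simp only [windowMeasure, Measure.coe_finsetSum, Finset.sum_apply, Measure.smul_apply,
    Measure.dirac_apply' _ (cylinder_isClopen (-(n : ℤ)) _).isOpen.measurableSet, smul_eq_mul,
    Set.indicator_apply, padWord_mem]
  rw [Finset.sum_eq_single c]
  · simp only [if_true, Pi.one_apply, mul_one]
  · intro b _ hb
    rw [if_neg hb, mul_zero]
  · exact fun hc => absurd (Finset.mem_univ c) hc

lemma exists_markovCylinders (S : MarkovSystem V E K) (μ : Measure K) [IsProbabilityMeasure μ]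
    (hμ : S.IsInvariant μ) : ∃ M : Measure (CodeSpace E), S.HasMarkovCylinders μ M := by
  have hwin : ∀ (n : ℕ) (m : ℤ) (l : List E), -(n : ℤ) ≤ m → m + l.length ≤ n + 1 →
      S.windowMeasure μ n (cylinderSet m l) = ENNReal.ofReal (∫ x, S.pathProb l x ∂μ) := by
    intro n m l h1 h2
    have := S.hasCylinders_of_window μ hμ (S.windowMeasure μ n) (-(n : ℤ)) (2 * n + 1)
      (S.windowMeasure_cylinder μ n) (m + n).toNat (2 * n + 1 - l.length - (m + n).toNat) l
      (by omega)
    rwa [show -(n : ℤ) + ((m + n).toNat : ℤ) = m by omega] at this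
  have hprob : ∀ n, IsProbabilityMeasure (S.windowMeasure μ n) := fun n => ⟨by
    have h := hwin n 0 [] (by omega) (by simp; omega)
    have hu : cylinderSet (0 : ℤ) ([] : List E) = Set.univ := by
      ext σ; simp [cylinderSet]
    rw [hu] at h
    simpa [pathProb] using h⟩
  let Ms : ℕ → ProbabilityMeasure (CodeSpace E) := fun n => ⟨S.windowMeasure μ n, hprob n⟩
  obtain ⟨M, -, hM⟩ := isCompact_univ.ultrafilter_le_nhds
    ((Filter.hyperfilter ℕ).map Ms) (by simp)
  have hlim : Tendsto Ms (Filter.hyperfilter ℕ) (𝓝 M) := hM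
  refine ⟨M, fun m l => ?_⟩
  have h1 := ProbabilityMeasure.tendsto_measure_of_null_frontier_of_tendsto' hlim
    (E := cylinderSet m l) (by rw [(cylinder_isClopen m l).frontier_eq]; simp)
  refine tendsto_nhds_unique h1 (tendsto_const_nhds.congr' ?_)
  refine Nat.hyperfilter_le_atTop ?_
  filter_upwards [eventually_ge_atTop (m.natAbs + l.length)] with n hn
  exact (hwin n m l (by omega) (by omega)).symm

lemma markovCylinders_unique (S : MarkovSystem V E K) (μ : Measure K) [IsProbabilityMeasure μ]
    (M M' : Measure (CodeSpace E)) (h : S.HasMarkovCylinders μ M)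
    (h' : S.HasMarkovCylinders μ M') : M = M' := by
  let r : (n : ℕ) → CodeSpace E → Fin (2 * n + 1) → E := fun n σ j => σ (-(n : ℤ) + (j : ℕ))
  have hr : ∀ n, Measurable (r n) := fun n =>
    measurable_pi_lambda _ fun j => measurable_pi_apply _
  have hu : cylinderSet (0 : ℤ) ([] : List E) = Set.univ := by ext σ; simp [cylinderSet]
  have huniv : M Set.univ = M' Set.univ := by rw [← hu, h, h']
  have hfin : IsFiniteMeasure M := ⟨by rw [← hu, h]; exact ENNReal.ofReal_lt_top⟩
  have hcyl : ∀ n (c : Fin (2 * n + 1) → E),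
      r n ⁻¹' {c} = cylinderSet (-(n : ℤ)) (List.ofFn c) := by
    intro n c
    ext σ
    simp only [Set.mem_preimage, Set.mem_singleton_iff, cylinderSet, Set.mem_ofPred_eq]
    constructor
    · rintro hc ⟨j, hj⟩
      have hj' : j < 2 * n + 1 := by simpa using hj
      rw [List.get_ofFn]
      exact congrFun hc ⟨j, hj'⟩
    · intro hc
      ext j
      have := hc ⟨j, by rw [List.length_ofFn]; exact j.2⟩
      rw [List.get_ofFn] at this
      exact this
  refine ext_of_generate_finite {s | ∃ n A, s = r n ⁻¹' A} ?_ ?_ ?_ huniv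
  · apply le_antisymm
    · refine iSup_le fun j => ?_
      rintro _ ⟨B, -, rfl⟩
      refine MeasurableSpace.measurableSet_generateFrom
        ⟨j.natAbs, {c | c ⟨(j + j.natAbs).toNat, by omega⟩ ∈ B}, ?_⟩
      ext σ
      simp only [Set.mem_preimage, Set.mem_ofPred_eq, r]
      rw [show -(j.natAbs : ℤ) + ((j + j.natAbs).toNat : ℤ) = j by omega]
    · refine MeasurableSpace.generateFrom_le ?_
      rintro _ ⟨n, A, rfl⟩
      exact hr n A.toFinite.measurableSet
  · have step : ∀ n n' (A : Set (Fin (2 * n + 1) → E)), n ≤ n' →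
        ∃ B, r n ⁻¹' A = r n' ⁻¹' B := by
      intro n n' A hn
      refine ⟨{c | (fun j : Fin (2 * n + 1) => c ⟨j + (n' - n), by omega⟩) ∈ A}, ?_⟩
      ext σ
      simp only [Set.mem_preimage, Set.mem_ofPred_eq]
      have : r n σ = fun j : Fin (2 * n + 1) => r n' σ ⟨j + (n' - n), by omega⟩ := by
        ext j
        simp only [r]
        congr 1
        push_cast [Nat.cast_sub hn]
        ring
      rw [this]
    rintro _ ⟨n, A, rfl⟩ _ ⟨n', A', rfl⟩ -
    obtain ⟨B, hB⟩ := step n (max n n') A (le_max_left _ _)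
    obtain ⟨B', hB'⟩ := step n' (max n n') A' (le_max_right _ _)
    exact ⟨max n n', B ∩ B', by rw [hB, hB', Set.preimage_inter]⟩
  · rintro _ ⟨n, A, rfl⟩
    classical
    have hA : A = ↑(A.toFinite.toFinset) := by simp
    rw [hA, ← sum_measure_preimage_singleton _ fun c _ => hr n (measurableSet_singleton c),
      ← sum_measure_preimage_singleton _ fun c _ => hr n (measurableSet_singleton c)]
    exact Finset.sum_congr rfl fun c _ => by rw [hcyl, h, h']

/-- The generalized Markov measure associated with the Markov system and its invariant measure:
the unique Borel measure on the code space with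
`M(ₘ[e₁, …, e_k]) = ∫ p_{e₁}(x) p_{e₂}(w_{e₁} x) ⋯ dμ(x)` for all cylinders. -/
def markovMeasure (S : MarkovSystem V E K) (μ : Measure K) [IsProbabilityMeasure μ]
    (hμ : S.IsInvariant μ) : Measure (CodeSpace E) :=
  (S.exists_markovCylinders μ hμ).choose

lemma markovMeasure_cylinder (S : MarkovSystem V E K) (μ : Measure K) [IsProbabilityMeasure μ]
    (hμ : S.IsInvariant μ) : S.HasMarkovCylinders μ (S.markovMeasure μ hμ) :=
  (S.exists_markovCylinders μ hμ).choose_spec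

end Existence

/-! ### Coding map and energy function -/

/-- The sequences that are paths of the graph. -/
def pathSpace (S : MarkovSystem V E K) : Set (CodeSpace E) :=
  {σ | ∀ j : ℤ, S.term (σ j) = S.init (σ (j + 1))}

/-- `w_{σ_0} ∘ w_{σ_{-1}} ∘ ⋯ ∘ w_{σ_{-n}}`. -/
def backComp (S : MarkovSystem V E K) (σ : CodeSpace E) : ℕ → K → K
  | 0 => S.w (σ 0)
  | n + 1 => S.backComp σ n ∘ S.w (σ (-((n + 1 : ℕ) : ℤ)))

/-- `w_{σ_0} ∘ ⋯ ∘ w_{σ_{-n}} (x_{i(σ_{-n})})`, for chosen points `x_v`. -/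
def backOrbit (S : MarkovSystem V E K) (x : V → K) (σ : CodeSpace E) (n : ℕ) : K :=
  S.backComp σ n (x (S.init (σ (-(n : ℤ)))))

/-- The set `D` of paths along which the backward orbit converges. -/
def convergenceSet [TopologicalSpace K] (S : MarkovSystem V E K) (x : V → K) :
    Set (CodeSpace E) :=
  {σ | σ ∈ S.pathSpace ∧ ∃ y, Tendsto (S.backOrbit x σ) atTop (𝓝 y)}

/-- `Y = ⋂_{k ∈ ℤ} Sᵏ(D)`, where the `k`-th power of the left shift is `σ ↦ (σ_{j+k})_j`. -/
def codingDomain [TopologicalSpace K] (S : MarkovSystem V E K) (x : V → K) :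
    Set (CodeSpace E) :=
  ⋂ k : ℤ, (fun (σ : CodeSpace E) (j : ℤ) => σ (j + k)) '' S.convergenceSet x

open Classical in
/-- The coding map `F(σ) = lim_{m → -∞} w_{σ_0} ∘ ⋯ ∘ w_{σ_m} (x_{i(σ_m)})`, where the limit
exists (and an arbitrary value elsewhere). -/
def codingMap [TopologicalSpace K] (S : MarkovSystem V E K) (x : V → K) (σ : CodeSpace E) : K :=
  if h : ∃ y, Tendsto (S.backOrbit x σ) atTop (𝓝 y) then h.choose else x (S.init (σ 0))

open Classical in
/-- The energy function: `u(σ) = log p_{σ_1}(F(σ))` on `Y` and `-∞` off `Y`. -/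
def energy [TopologicalSpace K] (S : MarkovSystem V E K) (x : V → K) (σ : CodeSpace E) : EReal :=
  if σ ∈ S.codingDomain x then ((Real.log (S.p (σ 1) (S.codingMap x σ)) : ℝ) : EReal) else ⊥

end MarkovSystem

end

/-! The claim splits into `h_Θ + ∫ u dΘ ≤ 0` for every invariant `Θ` and the reverse inequality for
`M`.

Upper bound. If `Θ` charges the complement of `Y`, then `∫ u dΘ = -∞`. Otherwise, since the
coordinates generate, `h_Θ` is controlled by the growth of the entropy of words
(`ksEntropy_leftShift_le_of_increments`). An increment of word entropy is a conditional entropy, and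
by the Gibbs inequality it is at most the expected cost `-log q` of any rule `q` that predicts the
next letter from the word before it (`finEntropy_codeWindow_succ_le`). The rule chosen is `p_e` at
the point `w_{σ_0} ∘ ⋯ ∘ w_{σ_{-n}} x_{i(σ_{-n})}`, which depends only on the word. On `Y` these
points converge to `F(σ)`, and the bound `p ≥ δ` permits dominated convergence, so the costs tend to
`-∫ u dΘ`.

Lower bound. Both terms are compared with `∫ ∑ₑ -pₑ log pₑ dμ`. The mass of a cylinder under `M` is
a `μ`-average of path probabilities, so Jensen and invariance of `μ` give `h_M ≥ ∫ ∑ₑ -pₑ log pₑ dμ`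
(`integral_localEntropy_le_ksEntropy`). Conversely, the cost of the above rule under `M` is the
`μ`-average of a cost for words generated from `y` but predicted from the base point `x_v` in the
same vertex set. By uniform continuity of `p` and average contraction, replacing `x_v` by `y`
changes this cost by at most `ε + C aⁿ d(y, x_v)` (`exists_crossCost_le`). The moment condition
makes the error integrable, and in the limit `-∫ u dM ≤ ∫ ∑ₑ -pₑ log pₑ dμ`
(`integral_log_codingMap_le`). -/

/-! ### Shannon entropy of random variables with finitely many values -/

section FiniteEntropy

variable {Ω ι κ ν : Type*} [MeasurableSpace Ω]
  [Fintype ι] [MeasurableSpace ι] [MeasurableSingletonClass ι]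
  [Fintype κ] [MeasurableSpace κ] [MeasurableSingletonClass κ]
  [Fintype ν] [MeasurableSpace ν] [MeasurableSingletonClass ν]

/-- The Gibbs inequality. -/
lemma sum_negMulLog_le_cross {ι : Type*} [Fintype ι] (p q : ι → ℝ) (hp : ∀ i, 0 ≤ p i)
    (hq : ∀ i, 0 ≤ q i) (hpq : ∀ i, 0 < p i → 0 < q i) (hsum : ∑ i, q i ≤ ∑ i, p i) :
    ∑ i, Real.negMulLog (p i) ≤ ∑ i, -(p i * Real.log (q i)) := by
  -- This is `log t ≤ t - 1` at `t = q i / p i`, multiplied by `p i`. Where `p i = 0` the left side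
  -- vanishes.
  have key : ∀ i, Real.negMulLog (p i) - -(p i * Real.log (q i)) ≤ q i - p i := by
    intro i
    rcases (hp i).eq_or_lt with h | h
    · simpa [← h] using hq i
    · have hqi := hpq i h
      have h1 := Real.log_le_sub_one_of_pos (div_pos hqi h)
      rw [Real.log_div hqi.ne' h.ne'] at h1
      have h2 := mul_le_mul_of_nonneg_left h1 h.le
      have h3 : p i * (q i / p i - 1) = q i - p i := by field_simp
      rw [h3] at h2
      simp only [Real.negMulLog]
      linarith
  have := Finset.sum_le_sum fun i (_ : i ∈ Finset.univ) => key i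
  rw [Finset.sum_sub_distrib, Finset.sum_sub_distrib] at this
  linarith

/-- The Shannon entropy of a random variable with finitely many values. -/
noncomputable def finEntropy (Θ : Measure Ω) (X : Ω → ι) : ℝ :=
  ∑ i, Real.negMulLog (Θ.real (X ⁻¹' {i}))

/-- The conditional entropy `H(X | Y) = H(X, Y) - H(Y)`. -/
noncomputable def condEntropy (Θ : Measure Ω) (X : Ω → ι) (Y : Ω → κ) : ℝ :=
  finEntropy Θ (fun ω => (X ω, Y ω)) - finEntropy Θ Y

variable (Θ : Measure Ω) [IsProbabilityMeasure Θ]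

lemma sum_real_preimage_mul_comp {Z : Ω → ι} (hZ : Measurable Z) (f : ι → κ) (g : κ → ℝ) :
    ∑ z, Θ.real (Z ⁻¹' {z}) * g (f z) = ∑ k, Θ.real ((f ∘ Z) ⁻¹' {k}) * g k := by
  classical
  rw [← Finset.sum_fiberwise Finset.univ f]
  refine Finset.sum_congr rfl fun k _ => ?_
  have h : (f ∘ Z) ⁻¹' {k} = Z ⁻¹' ↑(Finset.univ.filter fun z => f z = k) := by
    ext ω; simp
  rw [h, ← sum_measureReal_preimage_singleton _ fun z _ => hZ (measurableSet_singleton z),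
    Finset.sum_mul]
  exact Finset.sum_congr rfl fun z hz => by rw [(Finset.mem_filter.1 hz).2]

lemma sum_real_preimage_eq_one {Z : Ω → ι} (hZ : Measurable Z) :
    ∑ z, Θ.real (Z ⁻¹' {z}) = 1 := by
  rw [sum_measureReal_preimage_singleton _ fun z _ => hZ (measurableSet_singleton z)]
  simp

/-- Expressing a coarse entropy as a sum over the fine atoms lets entropies of different marginals
be combined term by term in the Gibbs inequality. -/
lemma finEntropy_comp_eq {Z : Ω → ι} (hZ : Measurable Z) (f : ι → κ) :
    finEntropy Θ (f ∘ Z)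
      = ∑ z, -(Θ.real (Z ⁻¹' {z}) * Real.log (Θ.real ((f ∘ Z) ⁻¹' {f z}))) := by
  rw [Finset.sum_neg_distrib, sum_real_preimage_mul_comp Θ hZ f
    (fun k => Real.log (Θ.real ((f ∘ Z) ⁻¹' {k}))), ← Finset.sum_neg_distrib]
  exact Finset.sum_congr rfl fun k _ => by rw [Real.negMulLog, neg_mul]

lemma real_preimage_le_comp (Z : Ω → ι) (f : ι → κ) (z : ι) :
    Θ.real (Z ⁻¹' {z}) ≤ Θ.real ((f ∘ Z) ⁻¹' {f z}) :=
  measureReal_mono fun ω hω => by simp_all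

lemma finEntropy_comp_le {Z : Ω → ι} (hZ : Measurable Z) (f : ι → κ) :
    finEntropy Θ (f ∘ Z) ≤ finEntropy Θ Z := by
  rw [finEntropy_comp_eq Θ hZ]
  refine Finset.sum_le_sum fun z _ => ?_
  rw [Real.negMulLog, neg_mul, neg_le_neg_iff]
  rcases (measureReal_nonneg (μ := Θ) (s := Z ⁻¹' {z})).eq_or_lt with h | h
  · simp [← h]
  · exact mul_le_mul_of_nonneg_left
      (Real.log_le_log h (real_preimage_le_comp Θ Z f z)) h.le

/-- Entropy does not increase when passing to a variable that is determined by the given one. -/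
lemma finEntropy_le_of_factors {X : Ω → κ} {Z : Ω → ι} (hZ : Measurable Z)
    (h : ∀ ω ω', Z ω = Z ω' → X ω = X ω') : finEntropy Θ X ≤ finEntropy Θ Z := by
  obtain ⟨ω₀⟩ : Nonempty Ω := nonempty_of_isProbabilityMeasure Θ
  have : Nonempty κ := ⟨X ω₀⟩
  obtain ⟨f, rfl⟩ := (Function.factorsThrough_iff (f := Z) X).1 fun ω ω' => h ω ω'
  exact finEntropy_comp_le Θ hZ f

lemma finEntropy_comp_measurePreserving {T : Ω → Ω} (hT : MeasurePreserving T Θ Θ)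
    {X : Ω → ι} (hX : Measurable X) : finEntropy Θ (X ∘ T) = finEntropy Θ X := by
  refine Finset.sum_congr rfl fun i _ => ?_
  rw [Set.preimage_comp, hT.measureReal_preimage (hX (measurableSet_singleton i)).nullMeasurableSet]

/-- Strong subadditivity of the entropy. -/
lemma finEntropy_submodular {X : Ω → ι} {Y : Ω → κ} {Z : Ω → ν} (hX : Measurable X)
    (hY : Measurable Y) (hZ : Measurable Z) :
    finEntropy Θ (fun ω => (X ω, Y ω, Z ω)) + finEntropy Θ Z
      ≤ finEntropy Θ (fun ω => (X ω, Z ω)) + finEntropy Θ (fun ω => (Y ω, Z ω)) := by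
  classical
  set W : Ω → ι × κ × ν := fun ω => (X ω, Y ω, Z ω) with hWdef
  have hW : Measurable W := hX.prodMk (hY.prodMk hZ)
  let f₁ : ι × κ × ν → ι × ν := fun w => (w.1, w.2.2)
  let f₂ : ι × κ × ν → κ × ν := fun w => (w.2.1, w.2.2)
  let f₃ : ι × κ × ν → ν := fun w => w.2.2
  have e₁ := finEntropy_comp_eq Θ hW f₁
  have e₂ := finEntropy_comp_eq Θ hW f₂
  have e₃ := finEntropy_comp_eq Θ hW f₃
  change finEntropy Θ (fun ω => (X ω, Z ω)) = _ at e₁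
  change finEntropy Θ (fun ω => (Y ω, Z ω)) = _ at e₂
  change finEntropy Θ Z = _ at e₃
  set P₁ : ι × ν → ℝ := fun w => Θ.real ((f₁ ∘ W) ⁻¹' {w})
  set P₂ : κ × ν → ℝ := fun w => Θ.real ((f₂ ∘ W) ⁻¹' {w})
  set P₃ : ν → ℝ := fun w => Θ.real ((f₃ ∘ W) ⁻¹' {w})
  have m₁ : ∀ c, ∑ x, P₁ (x, c) = P₃ c := by
    intro c
    have h := sum_real_preimage_mul_comp Θ (hX.prodMk hZ) (Prod.snd : ι × ν → ν)
      (fun k => if k = c then 1 else 0)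
    rw [Fintype.sum_prod_type] at h
    simp only [mul_ite, mul_one, mul_zero, Finset.sum_ite_eq', Finset.mem_univ, if_true] at h
    exact h
  have m₂ : ∀ c, ∑ y, P₂ (y, c) = P₃ c := by
    intro c
    have h := sum_real_preimage_mul_comp Θ (hY.prodMk hZ) (Prod.snd : κ × ν → ν)
      (fun k => if k = c then 1 else 0)
    rw [Fintype.sum_prod_type] at h
    simp only [mul_ite, mul_one, mul_zero, Finset.sum_ite_eq', Finset.mem_univ, if_true] at h
    exact h
  have hn₁ : ∀ w, 0 ≤ P₁ w := fun w => measureReal_nonneg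
  have hn₂ : ∀ w, 0 ≤ P₂ w := fun w => measureReal_nonneg
  have hn₃ : ∀ w, 0 ≤ P₃ w := fun w => measureReal_nonneg
  have l₁ : ∀ w, Θ.real (W ⁻¹' {w}) ≤ P₁ (f₁ w) := real_preimage_le_comp Θ W f₁
  have l₂ : ∀ w, Θ.real (W ⁻¹' {w}) ≤ P₂ (f₂ w) := real_preimage_le_comp Θ W f₂
  have l₃ : ∀ w, Θ.real (W ⁻¹' {w}) ≤ P₃ (f₃ w) := real_preimage_le_comp Θ W f₃
  -- The comparison law has the same pair marginals but makes `X` and `Y` conditionally independent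
  -- given `Z`. Atoms with `P₃ = 0` contribute nothing, since division by zero gives zero.
  have gibbs := sum_negMulLog_le_cross (fun w => Θ.real (W ⁻¹' {w}))
    (fun w => P₁ (f₁ w) * P₂ (f₂ w) / P₃ (f₃ w)) (fun w => measureReal_nonneg)
    (fun w => div_nonneg (mul_nonneg (hn₁ _) (hn₂ _)) (hn₃ _))
    (fun w hw => div_pos (mul_pos (hw.trans_le (l₁ w)) (hw.trans_le (l₂ w)))
      (hw.trans_le (l₃ w))) (by
    rw [sum_real_preimage_eq_one Θ hW, ← sum_real_preimage_eq_one Θ hZ,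
      Fintype.sum_prod_type, ]
    simp only [Fintype.sum_prod_type]
    have : ∑ x, ∑ y, ∑ z, P₁ (x, z) * P₂ (y, z) / P₃ z
        = ∑ z, (∑ x, P₁ (x, z)) * (∑ y, P₂ (y, z)) / P₃ z := by
      simp only [Finset.sum_mul_sum, Finset.sum_div]
      rw [Finset.sum_comm' (t' := Finset.univ) (s' := fun _ => Finset.univ) (by simp)]
      rw [Finset.sum_congr rfl fun y _ => Finset.sum_comm]
      rw [Finset.sum_comm]
      exact Finset.sum_congr rfl fun z _ => Finset.sum_comm
    refine this.trans_le (Finset.sum_le_sum fun z _ => ?_)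
    rw [m₁, m₂]
    exact (mul_self_div_self _).le)
  have hsplit : ∀ w, -(Θ.real (W ⁻¹' {w}) * Real.log (P₁ (f₁ w) * P₂ (f₂ w) / P₃ (f₃ w)))
      = -(Θ.real (W ⁻¹' {w}) * Real.log (P₁ (f₁ w)))
        + -(Θ.real (W ⁻¹' {w}) * Real.log (P₂ (f₂ w)))
        - -(Θ.real (W ⁻¹' {w}) * Real.log (P₃ (f₃ w))) := by
    intro w
    rcases (measureReal_nonneg (μ := Θ) (s := W ⁻¹' {w})).eq_or_lt with h | h
    · simp [← h]
    · rw [Real.log_div (mul_pos (h.trans_le (l₁ w)) (h.trans_le (l₂ w))).ne'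
        (h.trans_le (l₃ w)).ne', Real.log_mul (h.trans_le (l₁ w)).ne' (h.trans_le (l₂ w)).ne']
      ring
  simp only [hsplit] at gibbs
  rw [Finset.sum_sub_distrib, Finset.sum_add_distrib, ← e₁, ← e₂, ← e₃] at gibbs
  have : finEntropy Θ W ≤ finEntropy Θ (fun ω => (X ω, Z ω))
    + finEntropy Θ (fun ω => (Y ω, Z ω)) - finEntropy Θ Z := gibbs
  linarith

/-- Strong subadditivity with a constant third variable. -/
lemma finEntropy_pair_le {X : Ω → ι} {Y : Ω → κ} (hX : Measurable X) (hY : Measurable Y) :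
    finEntropy Θ (fun ω => (X ω, Y ω)) ≤ finEntropy Θ X + finEntropy Θ Y := by
  have h := finEntropy_submodular Θ hX hY (measurable_const (a := ()))
  have h1 := finEntropy_le_of_factors Θ (X := fun ω => (X ω, Y ω))
    (Z := fun ω => (X ω, Y ω, ())) (hX.prodMk (hY.prodMk measurable_const)) (by simp)
  have h2 := finEntropy_le_of_factors Θ (X := fun ω => (X ω, ())) hX (by simp)
  have h3 := finEntropy_le_of_factors Θ (X := fun ω => (Y ω, ())) hY (by simp)
  have h4 : finEntropy Θ (fun _ : Ω => ()) = 0 := by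
    simp [finEntropy]
  linarith

lemma condEntropy_le_finEntropy {X : Ω → ι} {Y : Ω → κ} (hX : Measurable X)
    (hY : Measurable Y) : condEntropy Θ X Y ≤ finEntropy Θ X := by
  have := finEntropy_pair_le Θ hX hY
  rw [condEntropy]; linarith

/-- Conditioning on more information does not increase the conditional entropy. -/
lemma condEntropy_le_of_factors_right {X : Ω → ι} {Y : Ω → κ} {Y' : Ω → ν} (hX : Measurable X)
    (hY : Measurable Y) (hY' : Measurable Y') (h : ∀ ω ω', Y ω = Y ω' → Y' ω = Y' ω') :
    condEntropy Θ X Y ≤ condEntropy Θ X Y' := by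
  have h0 := finEntropy_submodular Θ hX hY hY'
  have h1 := finEntropy_le_of_factors Θ (X := fun ω => (X ω, Y ω))
    (Z := fun ω => (X ω, Y ω, Y' ω)) (hX.prodMk (hY.prodMk hY')) (by simp_all)
  have h2 := finEntropy_le_of_factors Θ (X := fun ω => (Y ω, Y' ω)) hY
    (fun ω ω' hω => Prod.ext hω (h ω ω' hω))
  rw [condEntropy, condEntropy]; linarith

/-- Conditional entropy is monotone in variables determined modulo the condition. -/
lemma condEntropy_le_of_factors_left {X : Ω → ι} {X' : Ω → ν} {Y : Ω → κ} (hX : Measurable X)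
    (hY : Measurable Y) (h : ∀ ω ω', X ω = X ω' → Y ω = Y ω' → X' ω = X' ω') :
    condEntropy Θ X' Y ≤ condEntropy Θ X Y := by
  have h1 := finEntropy_le_of_factors Θ (X := fun ω => (X' ω, Y ω))
    (Z := fun ω => (X ω, Y ω)) (hX.prodMk hY) (fun ω ω' hω => by
      obtain ⟨h1, h2⟩ := Prod.mk.inj hω
      exact Prod.ext (h ω ω' h1 h2) h2)
  rw [condEntropy, condEntropy]; linarith

lemma condEntropy_pair_le {X : Ω → ι} {X' : Ω → ν} {Y : Ω → κ} (hX : Measurable X)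
    (hX' : Measurable X') (hY : Measurable Y) :
    condEntropy Θ (fun ω => (X ω, X' ω)) Y ≤ condEntropy Θ X Y + condEntropy Θ X' Y := by
  have h0 := finEntropy_submodular Θ hX hX' hY
  have h1 := finEntropy_le_of_factors Θ (X := fun ω => ((X ω, X' ω), Y ω))
    (Z := fun ω => (X ω, X' ω, Y ω)) (hX.prodMk (hX'.prodMk hY)) (by simp_all)
  rw [condEntropy, condEntropy, condEntropy]; linarith

lemma condEntropy_pi_le {n : ℕ} {X : Fin n → Ω → ι} {Y : Ω → κ} (hX : ∀ i, Measurable (X i))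
    (hY : Measurable Y) :
    condEntropy Θ (fun ω i => X i ω) Y ≤ ∑ i, condEntropy Θ (X i) Y := by
  induction n with
  | zero =>
    have := finEntropy_le_of_factors Θ (X := fun ω => ((fun i => X i ω : Fin 0 → ι), Y ω)) hY
      (fun ω ω' h => Prod.ext (Subsingleton.elim _ _) h)
    simp only [condEntropy, Finset.univ_eq_empty, Finset.sum_empty]
    linarith
  | succ n ih =>
    rw [Fin.sum_univ_castSucc]
    have hpi : Measurable fun ω (i : Fin n) => X i.castSucc ω :=
      measurable_pi_lambda _ fun i => hX _
    refine (condEntropy_le_of_factors_left Θ (hpi.prodMk (hX (Fin.last n))) hY ?_).trans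
      ((condEntropy_pair_le Θ hpi (hX (Fin.last n)) hY).trans
        (add_le_add (ih fun i => hX _) le_rfl))
    intro ω ω' h _
    obtain ⟨h1, h2⟩ := Prod.mk.inj h
    funext i
    exact Fin.lastCases h2 (fun j => congrFun h1 j) i

lemma condEntropy_comp_measurePreserving {T : Ω → Ω} (hT : MeasurePreserving T Θ Θ)
    {X : Ω → ι} {Y : Ω → κ} (hX : Measurable X) (hY : Measurable Y) :
    condEntropy Θ (X ∘ T) (Y ∘ T) = condEntropy Θ X Y := by
  have h1 := finEntropy_comp_measurePreserving Θ hT (hX.prodMk hY)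
  have h2 := finEntropy_comp_measurePreserving Θ hT hY
  rw [condEntropy, condEntropy, ← h1, ← h2]
  rfl

lemma integral_comp_finite {Z : Ω → ι} (hZ : Measurable Z) (f : ι → ℝ) :
    ∫ ω, f (Z ω) ∂Θ = ∑ z, Θ.real (Z ⁻¹' {z}) * f z := by
  have : IsProbabilityMeasure (Θ.map Z) := Measure.isProbabilityMeasure_map hZ.aemeasurable
  rw [← integral_map hZ.aemeasurable (measurable_of_finite f).aestronglyMeasurable,
    integral_fintype (Integrable.of_finite)]
  exact Finset.sum_congr rfl fun z _ => by
    rw [map_measureReal_apply hZ (measurableSet_singleton z), smul_eq_mul]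

/-- Conditional form of the Gibbs inequality. -/
lemma condEntropy_le_integral {X : Ω → ι} {Y : Ω → κ} (hX : Measurable X) (hY : Measurable Y)
    (Q : ι × κ → ℝ) (hQ : ∀ z, 0 ≤ Q z) (hsum : ∀ i, ∑ k, Q (i, k) ≤ 1)
    (hpos : ∀ᵐ ω ∂Θ, 0 < Q (X ω, Y ω)) :
    condEntropy Θ Y X ≤ ∫ ω, -Real.log (Q (X ω, Y ω)) ∂Θ := by
  have hXY := hX.prodMk hY
  have hcomm := finEntropy_le_of_factors Θ (X := fun ω => (Y ω, X ω)) hXY (by simp_all)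
  have eX := finEntropy_comp_eq Θ hXY Prod.fst
  have hle : ∀ z : ι × κ, Θ.real ((fun ω => (X ω, Y ω)) ⁻¹' {z}) ≤ Θ.real (X ⁻¹' {z.1}) :=
    real_preimage_le_comp Θ (fun ω => (X ω, Y ω)) Prod.fst
  change finEntropy Θ X = _ at eX
  have hQpos : ∀ z, 0 < Θ.real ((fun ω => (X ω, Y ω)) ⁻¹' {z}) → 0 < Q z := by
    intro z hz
    by_contra hneg
    refine hz.ne' ?_
    rw [measureReal_def, measure_mono_null _ (ae_iff.1 hpos)]
    · rfl
    · rintro ω rfl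
      exact hneg
  -- The comparison law draws `X` with its true distribution and then `Y` from the kernel `Q`.
  have gibbs := sum_negMulLog_le_cross
    (fun z => Θ.real ((fun ω => (X ω, Y ω)) ⁻¹' {z}))
    (fun z => Θ.real (X ⁻¹' {z.1}) * Q z)
    (fun z => measureReal_nonneg) (fun z => mul_nonneg measureReal_nonneg (hQ z))
    (fun z hz => mul_pos (hz.trans_le (hle z)) (hQpos z hz)) (by
      rw [sum_real_preimage_eq_one Θ hXY, ← sum_real_preimage_eq_one Θ hX,
        Fintype.sum_prod_type]
      refine Finset.sum_le_sum fun i _ => ?_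
      change ∑ k, Θ.real (X ⁻¹' {i}) * Q (i, k) ≤ _
      rw [← Finset.mul_sum]
      exact mul_le_of_le_one_right measureReal_nonneg (hsum i))
  have hsplit : ∀ z, -(Θ.real ((fun ω => (X ω, Y ω)) ⁻¹' {z})
        * Real.log (Θ.real (X ⁻¹' {z.1}) * Q z))
      = -(Θ.real ((fun ω => (X ω, Y ω)) ⁻¹' {z}) * Real.log (Θ.real (X ⁻¹' {z.1})))
        + Θ.real ((fun ω => (X ω, Y ω)) ⁻¹' {z}) * -Real.log (Q z) := by
    intro z
    rcases (measureReal_nonneg (μ := Θ) (s := (fun ω => (X ω, Y ω)) ⁻¹' {z})).eq_or_lt with h | h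
    · simp [← h]
    · rw [Real.log_mul (h.trans_le (hle z)).ne' (hQpos z h).ne']
      ring
  simp only [hsplit] at gibbs
  rw [Finset.sum_add_distrib] at gibbs
  have hint := integral_comp_finite Θ hXY (fun z => -Real.log (Q z))
  have : finEntropy Θ (fun ω => (X ω, Y ω)) ≤ finEntropy Θ X
      + ∫ ω, -Real.log (Q (X ω, Y ω)) ∂Θ := by
    rw [hint, eX]; exact gibbs
  rw [condEntropy]; linarith

end FiniteEntropy

/-! ### The coordinate partition generates the entropy of the shift -/

section Generator

variable {E : Type*}

/-- The word `σ_m, …, σ_{m+n-1}`. -/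
def codeWindow (m : ℤ) (n : ℕ) (σ : CodeSpace E) : Fin n → E := fun i => σ (m + (i : ℕ))

lemma leftShift_iterate_apply (k : ℕ) (σ : CodeSpace E) (j : ℤ) :
    leftShift^[k] σ j = σ (j + k) := by
  induction k generalizing σ with
  | zero => simp
  | succ k ih =>
    rw [Function.iterate_succ_apply, ih, leftShift]
    congr 1; push_cast; ring

lemma codeWindow_comp_iterate (m : ℤ) (n k : ℕ) :
    (codeWindow m n : CodeSpace E → _) ∘ leftShift^[k] = codeWindow (m + k) n := by
  funext σ i
  simp only [Function.comp_apply, codeWindow, leftShift_iterate_apply]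
  congr 1; ring

lemma codeWindow_apply_eq {m : ℤ} {n : ℕ} {σ τ : CodeSpace E}
    (h : codeWindow m n σ = codeWindow m n τ) {j : ℤ} (h1 : m ≤ j) (h2 : j < m + n) :
    σ j = τ j := by
  have := congrFun h ⟨(j - m).toNat, by omega⟩
  simp only [codeWindow] at this
  rwa [show m + ((j - m).toNat : ℤ) = j by omega] at this

lemma codeWindow_eq_of_subwindow {m m' : ℤ} {n n' : ℕ} (h1 : m ≤ m') (h2 : m' + n' ≤ m + n)
    {σ τ : CodeSpace E} (h : codeWindow m n σ = codeWindow m n τ) :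
    codeWindow m' n' σ = codeWindow m' n' τ := by
  funext i
  exact codeWindow_apply_eq h (by omega) (by omega)

variable [MeasurableSpace E]

lemma measurable_codeWindow (m : ℤ) (n : ℕ) :
    Measurable (codeWindow m n : CodeSpace E → Fin n → E) :=
  measurable_pi_lambda _ fun _ => measurable_pi_apply _

lemma measurable_leftShift : Measurable (leftShift : CodeSpace E → CodeSpace E) :=
  measurable_pi_lambda _ fun _ => measurable_pi_apply _

lemma joinEntropy_eq_finEntropy {X : Type*} [MeasurableSpace X] (T : X → X) (Θ : Measure X)
    {k : ℕ} (P : X → Fin k) (n : ℕ) :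
    joinEntropy T Θ P n = finEntropy Θ (fun x (i : Fin n) => P (T^[i] x)) := by
  refine Finset.sum_congr rfl fun c _ => ?_
  congr 2
  ext x
  simp [funext_iff]

variable [Fintype E] [MeasurableSingletonClass E]

/-- Any two centred windows lie in a common larger one, so finite set operations can be carried out
over a single window. -/
lemma isSetAlgebra_codeWindow :
    IsSetAlgebra {s : Set (CodeSpace E) |
      ∃ (n : ℕ) (A : Set (Fin (2 * n + 1) → E)), s = codeWindow (-n) (2 * n + 1) ⁻¹' A} := by
  have step : ∀ n n' (A : Set (Fin (2 * n + 1) → E)), n ≤ n' →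
      ∃ B, (codeWindow (-n) (2 * n + 1) ⁻¹' A : Set (CodeSpace E))
        = codeWindow (-n') (2 * n' + 1) ⁻¹' B := by
    intro n n' A hn
    -- Pulling the image back adds nothing because the larger word determines the smaller one.
    refine ⟨codeWindow (-n') (2 * n' + 1) '' (codeWindow (-n) (2 * n + 1) ⁻¹' A), ?_⟩
    refine (Set.subset_preimage_image _ _).antisymm ?_
    rintro σ ⟨τ, hτ, h⟩
    rw [Set.mem_preimage] at hτ ⊢
    rwa [← codeWindow_eq_of_subwindow (by omega) (by push_cast; omega) h]
  refine ⟨⟨0, ∅, rfl⟩, ?_, ?_⟩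
  · rintro _ ⟨n, A, rfl⟩
    exact ⟨n, Aᶜ, rfl⟩
  · rintro _ _ ⟨n, A, rfl⟩ ⟨n', A', rfl⟩
    obtain ⟨B, hB⟩ := step n (max n n') A (le_max_left _ _)
    obtain ⟨B', hB'⟩ := step n' (max n n') A' (le_max_right _ _)
    exact ⟨max n n', B ∪ B', by rw [hB, hB', Set.preimage_union]⟩

lemma generateFrom_codeWindow :
    (inferInstance : MeasurableSpace (CodeSpace E)) = MeasurableSpace.generateFrom
      {s | ∃ (n : ℕ) (A : Set (Fin (2 * n + 1) → E)), s = codeWindow (-n) (2 * n + 1) ⁻¹' A} := by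
  apply le_antisymm
  · refine iSup_le fun j => ?_
    rintro _ ⟨B, -, rfl⟩
    refine MeasurableSpace.measurableSet_generateFrom
      ⟨j.natAbs, {c | c ⟨(j + j.natAbs).toNat, by omega⟩ ∈ B}, ?_⟩
    ext σ
    simp only [Set.mem_preimage, Set.mem_ofPred_eq, codeWindow]
    rw [show -(j.natAbs : ℤ) + ((j + j.natAbs).toNat : ℤ) = j by omega]
  · refine MeasurableSpace.generateFrom_le ?_
    rintro _ ⟨n, A, rfl⟩
    exact measurable_codeWindow _ _ A.toFinite.measurableSet

variable (Θ : Measure (CodeSpace E)) [IsProbabilityMeasure Θ]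

open Classical in
lemma finEntropy_indicator (B : Set (CodeSpace E)) (hB : MeasurableSet B) :
    finEntropy Θ (fun σ => decide (σ ∈ B))
      = Real.negMulLog (Θ.real B) + Real.negMulLog (1 - Θ.real B) := by
  have h1 : (fun σ => decide (σ ∈ B)) ⁻¹' {true} = B := by ext; simp
  have h2 : (fun σ => decide (σ ∈ B)) ⁻¹' {false} = Bᶜ := by ext; simp
  rw [finEntropy, Fintype.sum_bool, h1, h2, measureReal_compl hB]
  simp

open Classical in
lemma measurable_decide_mem {B : Set (CodeSpace E)} (hB : MeasurableSet B) :
    Measurable fun σ => decide (σ ∈ B) :=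
  measurable_to_bool (by
    have : (fun σ => decide (σ ∈ B)) ⁻¹' {true} = B := by ext; simp
    rwa [this])

open Classical in
-- Approximate `B` by a window event `C`. Once the word is known, membership in `B` and in `symmDiff
-- B C` determine each other, and an event of small probability has small entropy.
lemma exists_condEntropy_indicator_lt (B : Set (CodeSpace E)) (hB : MeasurableSet B) {ε : ℝ}
    (hε : 0 < ε) :
    ∃ n : ℕ, condEntropy Θ (fun σ => decide (σ ∈ B)) (codeWindow (-n) (2 * n + 1)) < ε := by
  have hcont : Continuous fun t : ℝ => Real.negMulLog t + Real.negMulLog (1 - t) :=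
    Real.continuous_negMulLog.add (Real.continuous_negMulLog.comp (by fun_prop))
  obtain ⟨η, hη, hsmall⟩ := Metric.continuous_iff.1 hcont 0 ε hε
  obtain ⟨_, ⟨n, A, rfl⟩, -, hC⟩ := (Measure.MeasureDense.of_generateFrom_isSetAlgebra_finite Θ
    isSetAlgebra_codeWindow generateFrom_codeWindow).fin_meas_approx hB (measure_ne_top _ _) η hη
  set C : Set (CodeSpace E) := codeWindow (-n) (2 * n + 1) ⁻¹' A
  have hCm : MeasurableSet C := measurable_codeWindow _ _ A.toFinite.measurableSet
  have hBC : MeasurableSet (symmDiff B C) := hB.symmDiff hCm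
  refine ⟨n, ?_⟩
  refine (condEntropy_le_of_factors_left Θ (X := fun σ => decide (σ ∈ symmDiff B C))
    (measurable_decide_mem hBC) (measurable_codeWindow _ _) ?_).trans_lt
    ((condEntropy_le_finEntropy Θ (measurable_decide_mem hBC)
      (measurable_codeWindow _ _)).trans_lt ?_)
  · intro σ τ h1 h2
    have hC' : σ ∈ C ↔ τ ∈ C := by simp only [C, Set.mem_preimage, h2]
    simp only [decide_eq_decide, Set.mem_symmDiff] at h1 ⊢
    tauto
  · rw [finEntropy_indicator Θ _ hBC]
    have h := hsmall (Θ.real (symmDiff B C)) (by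
      rw [Real.dist_0_eq_abs, abs_of_nonneg measureReal_nonneg, measureReal_def]
      exact (ENNReal.lt_ofReal_iff_toReal_lt (measure_ne_top _ _)).1 hC)
    simp only [Real.negMulLog_zero, sub_zero, Real.negMulLog_one, add_zero,
      Real.dist_0_eq_abs] at h
    exact (le_abs_self _).trans_lt h

/-- A finite partition is determined by long words up to small conditional entropy. -/
lemma exists_condEntropy_codeWindow_le {k : ℕ} {P : CodeSpace E → Fin k} (hP : Measurable P)
    {ε : ℝ} (hε : 0 < ε) :
    ∃ n : ℕ, condEntropy Θ P (codeWindow (-n) (2 * n + 1)) ≤ ε := by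
  classical
  have hB : ∀ i, MeasurableSet (P ⁻¹' {i}) := fun i => hP (measurableSet_singleton i)
  -- The tolerance `ε / (k + 1)` is positive even for `k = 0`, and `k` of them add up to at most
  -- `ε`.
  choose n hn using fun i : Fin k =>
    exists_condEntropy_indicator_lt Θ (P ⁻¹' {i}) (hB i) (div_pos hε (Nat.cast_add_one_pos k))
  refine ⟨Finset.univ.sup n, ?_⟩
  set N := Finset.univ.sup n
  refine (condEntropy_le_of_factors_left Θ
    (X := fun σ (i : Fin k) => decide (σ ∈ P ⁻¹' {i}))
    (measurable_pi_lambda _ fun i => measurable_decide_mem (hB i))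
    (measurable_codeWindow _ _) ?_).trans ?_
  · intro σ τ h _
    have := congrFun h (P σ)
    simp only [Set.mem_preimage, Set.mem_singleton_iff, decide_eq_decide, true_iff] at this
    exact this.symm
  refine (condEntropy_pi_le Θ (fun i => measurable_decide_mem (hB i))
    (measurable_codeWindow _ _)).trans ?_
  calc _ ≤ ∑ _i : Fin k, ε / ((k : ℝ) + 1) := Finset.sum_le_sum fun i _ => by
        have hi : n i ≤ N := Finset.le_sup (Finset.mem_univ i)
        exact (condEntropy_le_of_factors_right Θ (measurable_decide_mem (hB i))
          (measurable_codeWindow _ _) (measurable_codeWindow (-(n i : ℤ)) (2 * n i + 1))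
          (fun σ τ h => codeWindow_eq_of_subwindow (by omega) (by push_cast; omega) h)).trans
          (hn i).le
    _ ≤ ε := by
        rw [Finset.sum_const, Finset.card_univ, Fintype.card_fin, nsmul_eq_mul, ← mul_div_assoc,
          div_le_iff₀ (Nat.cast_add_one_pos k)]
        nlinarith

/-! ### Growth of word entropy and the entropy of the shift. -/

variable {Θ}

lemma finEntropy_codeWindow (hΘ : MeasurePreserving leftShift Θ Θ) (m : ℤ) (n : ℕ) :
    finEntropy Θ (codeWindow m n) = finEntropy Θ (codeWindow 0 n) := by
  rcases le_total 0 m with h | h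
  · have := finEntropy_comp_measurePreserving Θ (hΘ.iterate m.toNat) (measurable_codeWindow 0 n)
    rw [codeWindow_comp_iterate] at this
    rw [← this]; congr 2; omega
  · have := finEntropy_comp_measurePreserving Θ (hΘ.iterate (-m).toNat)
      (measurable_codeWindow m n)
    rw [codeWindow_comp_iterate] at this
    rw [← this]; congr 2; omega

lemma finEntropy_codeWindow_add_le (hΘ : MeasurePreserving leftShift Θ Θ) (m n : ℕ) :
    finEntropy Θ (codeWindow 0 (m + n))
      ≤ finEntropy Θ (codeWindow 0 m) + finEntropy Θ (codeWindow 0 n) := by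
  have h1 := finEntropy_le_of_factors Θ (X := codeWindow 0 (m + n))
    (Z := fun σ => (codeWindow 0 m σ, codeWindow m n σ))
    ((measurable_codeWindow 0 m).prodMk (measurable_codeWindow m n)) (by
      intro σ τ h
      obtain ⟨h1, h2⟩ := Prod.mk.inj h
      funext i
      rcases lt_or_ge (i : ℕ) m with hi | hi
      · exact codeWindow_apply_eq h1 (by omega) (by omega)
      · exact codeWindow_apply_eq h2 (by omega) (by omega))
  have h2 := finEntropy_pair_le Θ (measurable_codeWindow 0 m)
    (measurable_codeWindow (E := E) m n)
  rw [finEntropy_codeWindow hΘ m n] at h2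
  exact h1.trans h2

/-- The word over `[-n, N + n - 1]` contains the window `[i - n, i + n]` for every `i < N`, so given
that word each of the `N` labels costs at most `ε`. The `2n` extra letters contribute the constant
`C`. -/
lemma exists_joinEntropy_le (hΘ : MeasurePreserving leftShift Θ Θ) {k : ℕ}
    {P : CodeSpace E → Fin k} (hP : Measurable P) {ε : ℝ} (hε : 0 < ε) :
    ∃ C : ℝ, ∀ N : ℕ,
      joinEntropy leftShift Θ P N ≤ finEntropy Θ (codeWindow 0 N) + N * ε + C := by
  obtain ⟨n, hn⟩ := exists_condEntropy_codeWindow_le Θ hP hε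
  refine ⟨finEntropy Θ (codeWindow 0 (2 * n)), fun N => ?_⟩
  have hA := measurable_codeWindow (E := E) (-n) (N + 2 * n)
  have hPi : ∀ i : Fin N, Measurable (P ∘ leftShift^[(i : ℕ)]) := fun i =>
    hP.comp (measurable_leftShift.iterate _)
  have hjoin : Measurable fun σ (i : Fin N) => P (leftShift^[(i : ℕ)] σ) :=
    measurable_pi_lambda _ hPi
  have h1 : ∀ i : Fin N, condEntropy Θ (P ∘ leftShift^[(i : ℕ)])
      (codeWindow (-n) (N + 2 * n)) ≤ ε := by
    intro i
    refine le_trans ?_ hn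
    rw [← condEntropy_comp_measurePreserving Θ (hΘ.iterate i) hP (measurable_codeWindow _ _),
      codeWindow_comp_iterate]
    exact condEntropy_le_of_factors_right Θ (hPi i) hA (measurable_codeWindow _ _)
      fun σ τ h => codeWindow_eq_of_subwindow (by omega) (by push_cast; omega) h
  have h2 := condEntropy_pi_le Θ hPi hA
  have h3 : ∑ i : Fin N, condEntropy Θ (P ∘ leftShift^[(i : ℕ)])
      (codeWindow (-n) (N + 2 * n)) ≤ N * ε := by
    refine (Finset.sum_le_sum fun i _ => h1 i).trans ?_
    simp
  have h4 := finEntropy_le_of_factors Θ (X := fun σ (i : Fin N) => P (leftShift^[(i : ℕ)] σ))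
    (Z := fun σ => (fun (i : Fin N) => P (leftShift^[(i : ℕ)] σ),
      codeWindow (-n) (N + 2 * n) σ)) (hjoin.prodMk hA) (by simp_all)
  have h5 := finEntropy_codeWindow_add_le hΘ N (2 * n)
  rw [← finEntropy_codeWindow hΘ (-n) (N + 2 * n)] at h5
  rw [joinEntropy_eq_finEntropy]
  simp only [condEntropy, Function.comp_apply] at h2 h3 h4 h5 ⊢
  linarith

/-- An asymptotic bound on the entropy of words bounds the Kolmogorov-Sinai entropy. -/
theorem ksEntropy_leftShift_le (hΘ : MeasurePreserving leftShift Θ Θ) (c : ℝ)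
    (h : ∀ ε > 0, ∀ᶠ N : ℕ in atTop, finEntropy Θ (codeWindow 0 N) ≤ N * (c + ε)) :
    ksEntropy leftShift Θ ≤ (c : EReal) := by
  refine iSup_le fun k => iSup_le fun P => iSup_le fun hP => ?_
  refine EReal.le_of_forall_lt_iff_le.1 fun z hz => ?_
  have hz' : c < z := EReal.coe_lt_coe_iff.1 hz
  -- One third each for the growth of the words, the approximation of the partition, and the
  -- boundary term `C / N`.
  set ε := (z - c) / 3 with hεdef
  have hε : 0 < ε := by rw [hεdef]; linarith
  obtain ⟨C, hC⟩ := exists_joinEntropy_le hΘ hP hε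
  refine limsup_le_of_le ⟨⊥, by simp⟩ ?_
  filter_upwards [h ε hε, eventually_gt_atTop 0,
    (tendsto_natCast_atTop_atTop (R := ℝ)).eventually_ge_atTop (C / ε)] with N h1 h2 h3
  rw [EReal.coe_le_coe_iff, div_le_iff₀ (by exact_mod_cast h2)]
  rw [div_le_iff₀ hε] at h3
  have := hC N
  have hz3 : z = c + 3 * ε := by rw [hεdef]; ring
  rw [hz3]
  linarith

lemma finEntropy_codeWindow_zero : finEntropy Θ (codeWindow (E := E) 0 0) = 0 := by
  have : ∀ c : Fin 0 → E, codeWindow (E := E) 0 0 ⁻¹' {c} = Set.univ := fun c =>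
    Set.eq_univ_of_forall fun σ => Subsingleton.elim _ _
  simp [finEntropy, this]

/-- If the entropy increments of words are bounded by a convergent sequence, its limit bounds the
Kolmogorov-Sinai entropy. -/
theorem ksEntropy_leftShift_le_of_increments (hΘ : MeasurePreserving leftShift Θ Θ)
    {b : ℕ → ℝ} {c : ℝ} (hb : Tendsto b atTop (𝓝 c)) (n₀ : ℕ)
    (h : ∀ n, finEntropy Θ (codeWindow 0 (n + n₀ + 1))
      ≤ finEntropy Θ (codeWindow 0 (n + n₀)) + b n) :
    ksEntropy leftShift Θ ≤ (c : EReal) := by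
  set H : ℕ → ℝ := fun n => finEntropy Θ (codeWindow 0 n) with hH
  -- The first `n₀` increments are kept as they are. They do not affect the Cesàro limit.
  set d : ℕ → ℝ := fun n => if n < n₀ then H (n + 1) - H n else b (n - n₀) with hd
  have hdlim : Tendsto d atTop (𝓝 c) := by
    refine (hb.comp (tendsto_sub_atTop_nat n₀)).congr' ?_
    filter_upwards [eventually_ge_atTop n₀] with n hn
    simp [hd, not_lt.2 hn]
  have hstep : ∀ n, H (n + 1) ≤ H n + d n := by
    intro n
    rcases lt_or_ge n n₀ with hn | hn
    · simp [hd, hn]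
    · have := h (n - n₀)
      rw [Nat.sub_add_cancel hn] at this
      simpa [hd, not_lt.2 hn] using this
  have hsum : ∀ n, H n ≤ ∑ i ∈ Finset.range n, d i := by
    intro n
    induction n with
    | zero => simp [hH, finEntropy_codeWindow_zero]
    | succ n ih => rw [Finset.sum_range_succ]; linarith [hstep n]
  refine ksEntropy_leftShift_le hΘ c fun ε hε => ?_
  filter_upwards [hdlim.cesaro.eventually (gt_mem_nhds (lt_add_of_pos_right c hε)),
    eventually_gt_atTop 0] with N h1 h2
  have hN : (0 : ℝ) < N := by exact_mod_cast h2
  rw [inv_mul_lt_iff₀ hN] at h1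
  exact (hsum N).trans h1.le

/-- Here `Q` is a rule that predicts the next letter from the preceding word. The extra entropy is
at most the expected logarithmic loss of the rule. -/
lemma finEntropy_codeWindow_succ_le {m : ℤ} {n : ℕ} (Q : (Fin n → E) × E → ℝ)
    (hQ : ∀ z, 0 ≤ Q z) (hsum : ∀ i, ∑ k, Q (i, k) ≤ 1)
    (hpos : ∀ᵐ σ ∂Θ, 0 < Q (codeWindow m n σ, σ (m + n))) :
    finEntropy Θ (codeWindow m (n + 1)) ≤ finEntropy Θ (codeWindow m n)
      + ∫ σ, -Real.log (Q (codeWindow m n σ, σ (m + n))) ∂Θ := by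
  have h := condEntropy_le_integral Θ (measurable_codeWindow m n)
    (measurable_pi_apply (m + (n : ℤ))) Q hQ hsum hpos
  have h1 := finEntropy_le_of_factors Θ (X := codeWindow m (n + 1))
    (Z := fun σ : CodeSpace E => (σ (m + (n : ℤ)), codeWindow m n σ))
    ((measurable_pi_apply _).prodMk (measurable_codeWindow m n)) (by
      intro σ τ h
      obtain ⟨h1, h2⟩ := Prod.mk.inj h
      funext i
      rcases lt_or_ge (i : ℕ) n with hi | hi
      · exact codeWindow_apply_eq h2 (by omega) (by omega)
      · have : (i : ℕ) = n := by omega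
        simp only [codeWindow, this]
        exact h1)
  rw [condEntropy] at h
  linarith

/-- The entropy of the full shift is at most the logarithm of the number of symbols. -/
theorem ksEntropy_leftShift_le_log_card (hΘ : MeasurePreserving leftShift Θ Θ) :
    ksEntropy leftShift Θ ≤ (Real.log (Fintype.card E) : EReal) := by
  obtain ⟨σ₀⟩ : Nonempty (CodeSpace E) := nonempty_of_isProbabilityMeasure Θ
  have : Nonempty E := ⟨σ₀ 0⟩
  have hcard : (0 : ℝ) < Fintype.card E := by exact_mod_cast Fintype.card_pos
  refine ksEntropy_leftShift_le_of_increments hΘ tendsto_const_nhds 0 fun n => ?_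
  -- The uniform prediction rule has constant loss `log |E|`.
  refine (finEntropy_codeWindow_succ_le (m := 0) (n := n)
    (fun _ => (Fintype.card E : ℝ)⁻¹) (fun _ => by positivity) (fun _ => ?_)
    (Eventually.of_forall fun _ => by positivity)).trans (le_of_eq ?_)
  · simp [hcard.ne']
  · simp [Real.log_inv]

end Generator

/-! ### The energy function of a Markov system -/

namespace MarkovSystem

/-! ### Words, backward compositions and transition probabilities. -/

section Combinatorial

variable {V E K : Type*} [Fintype E] [MeasurableSpace K] (S : MarkovSystem V E K)

/-- `p_{c_n}(w_{c_{n-1}} ∘ ⋯ ∘ w_{c_0} y)`. -/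
def lastProb : (n : ℕ) → (Fin (n + 1) → E) → K → ℝ
  | 0, c, y => S.p (c 0) y
  | n + 1, c, y => lastProb n (Fin.tail c) (S.w (c 0) y)

lemma lastProb_nonneg (n : ℕ) (c : Fin (n + 1) → E) (y : K) : 0 ≤ S.lastProb n c y := by
  induction n generalizing y with
  | zero => exact S.p_nonneg _ _
  | succ n ih => exact ih _ _

/-- The last letter enters only through `p_e` at a point fixed by the earlier letters and `y`. Hence
`lastProb` qualifies as a prediction rule. -/
lemma sum_lastProb_snoc (n : ℕ) (c : Fin n → E) (y : K) :
    ∑ e, S.lastProb n (Fin.snoc (α := fun _ => E) c e) y = 1 := by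
  induction n generalizing y with
  | zero => simpa [lastProb, Fin.snoc] using S.p_sum y
  | succ n ih =>
    rw [← ih (Fin.tail c) (S.w (c 0) y)]
    refine Finset.sum_congr rfl fun e _ => ?_
    have h0 : Fin.snoc (α := fun _ => E) c e 0 = c 0 := by
      rw [← Fin.castSucc_zero, Fin.snoc_castSucc]
    rw [lastProb, h0]
    congr 1
    funext i
    refine Fin.lastCases ?_ (fun j => ?_) i
    · simp [Fin.tail, Fin.succ_last]
    · simp only [Fin.tail, Fin.succ_castSucc, Fin.snoc_castSucc]

/-- Both recursions remove the oldest letter `σ_{-n}`, which is the innermost map of the backward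
composition. The window ends at `σ_1`, one letter beyond the composition. -/
lemma lastProb_codeWindow (n : ℕ) (σ : CodeSpace E) (y : K) :
    S.lastProb (n + 1) (codeWindow (-n) (n + 2) σ) y = S.p (σ 1) (S.backComp σ n y) := by
  induction n generalizing y with
  | zero => simp [lastProb, backComp, codeWindow, Fin.tail]
  | succ n ih =>
    rw [lastProb, backComp, Function.comp_apply, ← ih]
    congr 1
    · funext i
      simp only [Fin.tail, codeWindow, Fin.val_succ]
      congr 1; push_cast; ring

variable {S}

lemma backComp_mem {σ : CodeSpace E} (hσ : σ ∈ S.pathSpace) (n : ℕ) {y : K}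
    (hy : y ∈ S.vertexSet (S.init (σ (-(n : ℤ))))) :
    S.backComp σ n y ∈ S.vertexSet (S.init (σ 1)) := by
  induction n generalizing y with
  | zero =>
    have h := S.w_mapsTo (σ 0) (by simpa using hy)
    rwa [hσ 0] at h
  | succ n ih =>
    have h := S.w_mapsTo _ hy
    rw [hσ] at h
    refine ih ?_
    rwa [show -((n + 1 : ℕ) : ℤ) + 1 = -(n : ℤ) by push_cast; ring] at h

lemma backOrbit_mem {x : V → K} (hx : ∀ v, x v ∈ S.vertexSet v) {σ : CodeSpace E}
    (hσ : σ ∈ S.pathSpace) (n : ℕ) : S.backOrbit x σ n ∈ S.vertexSet (S.init (σ 1)) :=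
  backComp_mem hσ n (hx _)

end Combinatorial

/-! ### Limits of backward orbits. -/

section Topological

variable {V E K : Type*} [Fintype E] [MetricSpace K] [MeasurableSpace K]
  {S : MarkovSystem V E K} {x : V → K}

lemma mem_codingDomain_iff {σ : CodeSpace E} :
    σ ∈ S.codingDomain x ↔ ∀ k : ℤ, (fun j => σ (j - k)) ∈ S.convergenceSet x := by
  rw [codingDomain, Set.mem_iInter]
  refine forall_congr' fun k => ⟨?_, fun h => ⟨_, h, ?_⟩⟩
  · rintro ⟨τ, hτ, rfl⟩
    simpa using hτ
  · funext j; simp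

lemma codingDomain_subset {σ : CodeSpace E} (hσ : σ ∈ S.codingDomain x) :
    σ ∈ S.convergenceSet x := by
  simpa using mem_codingDomain_iff.1 hσ 0

lemma tendsto_codingMap {σ : CodeSpace E} (hσ : σ ∈ S.convergenceSet x) :
    Tendsto (S.backOrbit x σ) atTop (𝓝 (S.codingMap x σ)) := by
  rw [codingMap, dif_pos hσ.2]
  exact hσ.2.choose_spec

/-- The complement is the union of the other open cells. Limits of backward orbits therefore stay in
the cell where `p ≥ δ` holds and `p` is continuous. -/
lemma isClosed_vertexSet (hopen : ∀ v, IsOpen (S.vertexSet v)) (v : V) :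
    IsClosed (S.vertexSet v) := by
  have : S.vertexSet v = (⋃ v' ∈ {v' | v' ≠ v}, S.vertexSet v')ᶜ := by
    ext y
    simp only [Set.mem_compl_iff, Set.mem_iUnion, not_exists]
    refine ⟨fun hy v' hv' hy' => Set.disjoint_left.1 (S.vertexSet_disjoint hv') hy' hy,
      fun h => ?_⟩
    obtain ⟨v', hv'⟩ := Set.mem_iUnion.1 (S.vertexSet_cover.symm ▸ Set.mem_univ y)
    by_cases hvv : v' = v
    · rwa [← hvv]
    · exact absurd hv' (h v' hvv)
  rw [this, isClosed_compl_iff]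
  exact isOpen_biUnion fun v' _ => hopen v'

lemma codingMap_mem (hopen : ∀ v, IsOpen (S.vertexSet v)) (hx : ∀ v, x v ∈ S.vertexSet v)
    {σ : CodeSpace E} (hσ : σ ∈ S.convergenceSet x) :
    S.codingMap x σ ∈ S.vertexSet (S.init (σ 1)) :=
  (isClosed_vertexSet hopen _).mem_of_tendsto (tendsto_codingMap hσ)
    (Eventually.of_forall fun n => backOrbit_mem hx hσ.1 n)

lemma tendsto_log_backOrbit (hopen : ∀ v, IsOpen (S.vertexSet v))
    (hunif : ∀ e, UniformContinuousOn (S.p e) (S.vertexSet (S.init e)))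
    {δ : ℝ} (hδ : 0 < δ) (hp : ∀ e, ∀ y ∈ S.vertexSet (S.init e), δ ≤ S.p e y)
    (hx : ∀ v, x v ∈ S.vertexSet v) {σ : CodeSpace E} (hσ : σ ∈ S.convergenceSet x) :
    Tendsto (fun n => Real.log (S.p (σ 1) (S.backOrbit x σ n))) atTop
      (𝓝 (Real.log (S.p (σ 1) (S.codingMap x σ)))) := by
  have hmem := codingMap_mem hopen hx hσ
  have hc : ContinuousAt (S.p (σ 1)) (S.codingMap x σ) :=
    (hunif (σ 1)).continuousOn.continuousAt ((hopen _).mem_nhds hmem)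
  exact (hc.tendsto.comp (tendsto_codingMap hσ)).log (hδ.trans_le (hp _ _ hmem)).ne'

lemma abs_log_p_le {δ : ℝ} (hδ : 0 < δ) (hp : ∀ e, ∀ y ∈ S.vertexSet (S.init e), δ ≤ S.p e y)
    {e : E} {y : K} (hy : y ∈ S.vertexSet (S.init e)) :
    |Real.log (S.p e y)| ≤ -Real.log δ := by
  have h1 := Real.log_nonpos (S.p_nonneg e y) (S.p_le_one e y)
  rw [abs_of_nonpos h1, neg_le_neg_iff]
  exact Real.log_le_log hδ (hp e y hy)

end Topological

/-! ### Measurability and integrals of the energy, and the upper bound for the pressure. -/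

section Measurable

variable {V E K : Type*} [Fintype E] [MeasurableSpace E] [MeasurableSingletonClass E]
  [MetricSpace K] [ProperSpace K] [MeasurableSpace K] [BorelSpace K]
  {S : MarkovSystem V E K} {x : V → K}

lemma measurable_w_coord (j : ℤ) {y : CodeSpace E → K} (hy : Measurable y) :
    Measurable fun σ : CodeSpace E => S.w (σ j) (y σ) := by
  have h : Measurable fun z : E × K => S.w z.1 z.2 :=
    measurable_from_prod_countable_right fun e => S.w_measurable e
  exact h.comp ((measurable_pi_apply j).prodMk hy)

lemma measurable_backComp (n : ℕ) {y : CodeSpace E → K} (hy : Measurable y) :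
    Measurable fun σ : CodeSpace E => S.backComp σ n (y σ) := by
  induction n generalizing y with
  | zero => exact measurable_w_coord 0 hy
  | succ n ih => exact ih (measurable_w_coord _ hy)

lemma measurable_backOrbit (n : ℕ) : Measurable fun σ : CodeSpace E => S.backOrbit x σ n :=
  measurable_backComp n ((measurable_of_finite fun e => x (S.init e)).comp (measurable_pi_apply _))

lemma measurable_log_backOrbit (n : ℕ) :
    Measurable fun σ : CodeSpace E => Real.log (S.p (σ 1) (S.backOrbit x σ n)) := by
  have h : Measurable fun z : E × K => S.p z.1 z.2 :=
    measurable_from_prod_countable_right fun e => S.p_measurable e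
  exact (h.comp ((measurable_pi_apply 1).prodMk (measurable_backOrbit n))).log

lemma measurableSet_convergenceSet : MeasurableSet (S.convergenceSet x) := by
  have h1 : MeasurableSet S.pathSpace := by
    have : S.pathSpace = ⋂ j : ℤ, (fun σ : CodeSpace E => (σ j, σ (j + 1))) ⁻¹'
        {z | S.term z.1 = S.init z.2} := by
      ext σ; simp [pathSpace]
    rw [this]
    exact MeasurableSet.iInter fun j => ((measurable_pi_apply j).prodMk (measurable_pi_apply _))
      (Set.toFinite _).measurableSet
  exact h1.inter (measurableSet_exists_tendsto fun n => measurable_backOrbit n)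

lemma measurableSet_codingDomain : MeasurableSet (S.codingDomain x) := by
  have : S.codingDomain x = ⋂ k : ℤ, (fun (σ : CodeSpace E) (j : ℤ) => σ (j - k)) ⁻¹'
      S.convergenceSet x := by
    ext σ; simp [mem_codingDomain_iff]
  rw [this]
  exact MeasurableSet.iInter fun k =>
    (measurable_pi_lambda _ fun j => measurable_pi_apply _) measurableSet_convergenceSet

variable (hopen : ∀ v, IsOpen (S.vertexSet v))
  (hunif : ∀ e, UniformContinuousOn (S.p e) (S.vertexSet (S.init e)))
  {δ : ℝ} (hδ : 0 < δ) (hp : ∀ e, ∀ y ∈ S.vertexSet (S.init e), δ ≤ S.p e y)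
  (hx : ∀ v, x v ∈ S.vertexSet v)
include hopen hunif hδ hp hx

lemma isEnergyFunction_energy : IsEnergyFunction (S.energy x) := by
  classical
  refine ⟨?_, fun σ => ?_⟩
  -- Replacing `F` by the `n`-th backward orbit on `Y` gives measurable functions with pointwise
  -- limit `u`.
  · let g : ℕ → CodeSpace E → EReal := fun n σ => if σ ∈ S.codingDomain x then
      ((Real.log (S.p (σ 1) (S.backOrbit x σ n)) : ℝ) : EReal) else ⊥
    refine measurable_of_tendsto_metrizable (f := g) (fun n => ?_) (tendsto_pi_nhds.2 fun σ => ?_)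
    · exact Measurable.ite measurableSet_codingDomain
        (measurable_log_backOrbit n).coe_real_ereal measurable_const
    · by_cases hσ : σ ∈ S.codingDomain x
      · simp only [g, energy, hσ, if_true]
        exact (continuous_coe_real_ereal.tendsto _).comp
          (tendsto_log_backOrbit hopen hunif hδ hp hx (codingDomain_subset hσ))
      · simp only [g, energy, hσ, if_false]
        exact tendsto_const_nhds
  · rw [energy]
    split_ifs
    · exact_mod_cast Real.log_nonpos (S.p_nonneg _ _) (S.p_le_one _ _)
    · exact bot_le

variable {Θ : Measure (CodeSpace E)} [IsProbabilityMeasure Θ]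

lemma tendsto_integral_log_backOrbit (hY : ∀ᵐ σ ∂Θ, σ ∈ S.codingDomain x) :
    Tendsto (fun n => ∫ σ, -Real.log (S.p (σ 1) (S.backOrbit x σ n)) ∂Θ) atTop
      (𝓝 (∫ σ, -Real.log (S.p (σ 1) (S.codingMap x σ)) ∂Θ)) := by
  refine tendsto_integral_of_dominated_convergence (fun _ => -Real.log δ)
    (fun n => (measurable_log_backOrbit n).neg.aestronglyMeasurable) (integrable_const _)
    (fun n => ?_) ?_
  · filter_upwards [hY] with σ hσ
    rw [norm_neg, Real.norm_eq_abs]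
    exact abs_log_p_le hδ hp (backOrbit_mem hx (codingDomain_subset hσ).1 n)
  · filter_upwards [hY] with σ hσ
    exact (tendsto_log_backOrbit hopen hunif hδ hp hx (codingDomain_subset hσ)).neg

lemma energyIntegral_energy_eq (hY : ∀ᵐ σ ∂Θ, σ ∈ S.codingDomain x) :
    energyIntegral Θ (S.energy x)
      = ((-∫ σ, -Real.log (S.p (σ 1) (S.codingMap x σ)) ∂Θ : ℝ) : EReal) := by
  have hint : Integrable (fun σ => -Real.log (S.p (σ 1) (S.codingMap x σ))) Θ := by
    refine Integrable.of_bound (aestronglyMeasurable_of_tendsto_ae atTop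
      (fun n => (measurable_log_backOrbit (S := S) (x := x) n).neg.aestronglyMeasurable) ?_)
      (-Real.log δ) ?_
    · filter_upwards [hY] with σ hσ
      exact (tendsto_log_backOrbit hopen hunif hδ hp hx (codingDomain_subset hσ)).neg
    · filter_upwards [hY] with σ hσ
      rw [norm_neg, Real.norm_eq_abs]
      exact abs_log_p_le hδ hp (codingMap_mem hopen hx (codingDomain_subset hσ))
  have hnn : ∀ σ, 0 ≤ -Real.log (S.p (σ 1) (S.codingMap x σ)) := fun σ =>
    neg_nonneg.2 (Real.log_nonpos (S.p_nonneg _ _) (S.p_le_one _ _))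
  have hlint : ∫⁻ σ, (-S.energy x σ).toENNReal ∂Θ
      = ENNReal.ofReal (∫ σ, -Real.log (S.p (σ 1) (S.codingMap x σ)) ∂Θ) := by
    rw [ofReal_integral_eq_lintegral_ofReal hint (Eventually.of_forall hnn)]
    refine lintegral_congr_ae ?_
    filter_upwards [hY] with σ hσ
    rw [energy, if_pos hσ, ← EReal.coe_neg, EReal.toENNReal_of_ne_top (EReal.coe_ne_top _),
      EReal.toReal_coe]
  rw [energyIntegral, hlint, EReal.coe_ennreal_ofReal, max_eq_left (integral_nonneg hnn),
    EReal.coe_neg]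

omit hopen hunif hδ hp hx in
-- The energy is `-∞` on a set of positive mass.
lemma energyIntegral_energy_eq_bot (hY : ¬ ∀ᵐ σ ∂Θ, σ ∈ S.codingDomain x) :
    energyIntegral Θ (S.energy x) = ⊥ := by
  have hpos : Θ (S.codingDomain x)ᶜ ≠ 0 := fun h => hY (ae_iff.2 h)
  have : ∫⁻ σ, (-S.energy x σ).toENNReal ∂Θ = ⊤ := by
    refine top_le_iff.1 ?_
    calc ⊤ = ∫⁻ _ in (S.codingDomain x)ᶜ, ⊤ ∂Θ := by
          rw [setLIntegral_const, ENNReal.top_mul hpos]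
      _ = ∫⁻ σ in (S.codingDomain x)ᶜ, (-S.energy x σ).toENNReal ∂Θ := by
          refine setLIntegral_congr_fun measurableSet_codingDomain.compl fun σ hσ => ?_
          simp [energy, if_neg (show σ ∉ S.codingDomain x from hσ)]
      _ ≤ _ := setLIntegral_le_lintegral _ _
  rw [energyIntegral, this]
  rfl

/-- The variational inequality `h_Θ + Θ(u) ≤ 0`. -/
theorem ksEntropy_add_energyIntegral_le_zero (hΘ : MeasurePreserving leftShift Θ Θ) :
    ksEntropy leftShift Θ + energyIntegral Θ (S.energy x) ≤ 0 := by
  by_cases hY : ∀ᵐ σ ∂Θ, σ ∈ S.codingDomain x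
  swap
  · rw [energyIntegral_energy_eq_bot hY, EReal.add_bot]
    exact bot_le
  rw [energyIntegral_energy_eq hopen hunif hδ hp hx hY]
  -- The offset is `1` because the word `σ_{-n}, …, σ_0` has `n + 1` letters and the predicted
  -- letter is `σ_1`. The base point depends only on the first letter of that word, so the rule is a
  -- function of the word.
  have hle := ksEntropy_leftShift_le_of_increments hΘ
    (tendsto_integral_log_backOrbit hopen hunif hδ hp hx hY) 1 fun n => by
    have hQeq : ∀ σ : CodeSpace E, S.lastProb (n + 1) (Fin.snoc (α := fun _ => E)
          (codeWindow (-n) (n + 1) σ) (σ (-n + ((n + 1 : ℕ) : ℤ))))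
          (x (S.init (codeWindow (-n) (n + 1) σ 0))) = S.p (σ 1) (S.backOrbit x σ n) := by
      intro σ
      rw [backOrbit, ← lastProb_codeWindow]
      congr 1
      · funext i
        refine Fin.lastCases ?_ (fun j => ?_) i
        · simp [codeWindow]
        · simp [codeWindow]
      · simp [codeWindow]
    have h := finEntropy_codeWindow_succ_le (Θ := Θ) (m := -n) (n := n + 1)
      (fun z => S.lastProb (n + 1) (Fin.snoc (α := fun _ => E) z.1 z.2) (x (S.init (z.1 0))))
      (fun z => S.lastProb_nonneg _ _ _) (fun c => (S.sum_lastProb_snoc _ c (x (S.init (c 0)))).le) (by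
        filter_upwards [hY] with σ hσ
        rw [hQeq]
        exact hδ.trans_le (hp _ _ (backOrbit_mem hx (codingDomain_subset hσ).1 n)))
    simp only [hQeq] at h
    rwa [finEntropy_codeWindow hΘ (-n) (n + 1), finEntropy_codeWindow hΘ (-n) (n + 1 + 1)] at h
  refine (add_le_add_left hle _).trans (le_of_eq ?_)
  rw [← EReal.coe_add, add_neg_cancel, EReal.coe_zero]

end Measurable

end MarkovSystem

/-! ### The generalized Markov measure attains the pressure -/

namespace MarkovSystem

/-! ### Entropy and prediction cost of words generated from a point. -/

section WordSums

variable {V E K : Type*} [Fintype E] [MeasurableSpace K] (S : MarkovSystem V E K)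

lemma sum_word_succ {n : ℕ} (f : (Fin (n + 1) → E) → ℝ) :
    ∑ c, f c = ∑ e, ∑ c : Fin n → E, f (Fin.cons (α := fun _ => E) e c) := by
  rw [← (Fin.consEquiv fun _ : Fin (n + 1) => E).sum_comp, Fintype.sum_prod_type]
  rfl

lemma pathProb_ofFn_cons {n : ℕ} (e : E) (c : Fin n → E) (y : K) :
    S.pathProb (List.ofFn (Fin.cons (α := fun _ => E) e c)) y
      = S.p e y * S.pathProb (List.ofFn c) (S.w e y) := by
  rw [List.ofFn_succ]
  simp [pathProb]

lemma sum_pathProb_ofFn (n : ℕ) (y : K) :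
    ∑ c : Fin n → E, S.pathProb (List.ofFn c) y = 1 := by
  induction n generalizing y with
  | zero => simp [pathProb]
  | succ n ih =>
    rw [sum_word_succ]
    simp only [pathProb_ofFn_cons, ← Finset.mul_sum, ih, mul_one]
    exact S.p_sum y

/-- The entropy of the transition probabilities at a point. -/
noncomputable def localEntropy (y : K) : ℝ := ∑ e, Real.negMulLog (S.p e y)

/-- The chain rule: the entropy of the first letter, plus the mean entropy of the remaining word
started from the image point. -/
lemma sum_negMulLog_pathProb_succ (n : ℕ) (y : K) :
    ∑ c : Fin (n + 1) → E, Real.negMulLog (S.pathProb (List.ofFn c) y)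
      = S.localEntropy y
        + S.markovOp (fun z => ∑ c : Fin n → E, Real.negMulLog (S.pathProb (List.ofFn c) z)) y := by
  rw [sum_word_succ, localEntropy, markovOp, ← Finset.sum_add_distrib]
  refine Finset.sum_congr rfl fun e _ => ?_
  simp only [pathProb_ofFn_cons, Real.negMulLog_mul, Finset.sum_add_distrib, ← Finset.mul_sum,
    ← Finset.sum_mul, sum_pathProb_ofFn, one_mul]

lemma negMulLog_mem_Icc {t : ℝ} (h0 : 0 ≤ t) (h1 : t ≤ 1) :
    0 ≤ Real.negMulLog t ∧ Real.negMulLog t ≤ 1 := by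
  refine ⟨Real.negMulLog_nonneg h0 h1, ?_⟩
  rcases h0.eq_or_lt with h | h
  · simp [← h]
  · have h2 := Real.one_sub_inv_le_log_of_pos h
    have h3 := mul_le_mul_of_nonneg_left h2 h0
    have h4 : t * (1 - t⁻¹) = t - 1 := by field_simp
    rw [Real.negMulLog]
    linarith

lemma measurable_negMulLog_pathProb (l : List E) :
    Measurable fun y => Real.negMulLog (S.pathProb l y) :=
  Real.continuous_negMulLog.measurable.comp (S.pathProb_measurable l)

lemma abs_sum_negMulLog_pathProb_le (n : ℕ) (y : K) :
    |∑ c : Fin n → E, Real.negMulLog (S.pathProb (List.ofFn c) y)|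
      ≤ Fintype.card (Fin n → E) := by
  have h := fun c : Fin n → E =>
    negMulLog_mem_Icc (S.pathProb_mem (List.ofFn c) y).1 (S.pathProb_mem (List.ofFn c) y).2
  rw [abs_of_nonneg (Finset.sum_nonneg fun c _ => (h c).1)]
  refine (Finset.sum_le_sum fun c _ => (h c).2).trans ?_
  simp

lemma measurable_localEntropy : Measurable S.localEntropy :=
  Finset.measurable_fun_sum _ fun e _ =>
    Real.continuous_negMulLog.measurable.comp (S.p_measurable e)

lemma localEntropy_mem (y : K) : 0 ≤ S.localEntropy y ∧ S.localEntropy y ≤ Fintype.card E := by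
  have h := fun e : E => negMulLog_mem_Icc (S.p_nonneg e y) (S.p_le_one e y)
  refine ⟨Finset.sum_nonneg fun e _ => (h e).1, (Finset.sum_le_sum fun e _ => (h e).2).trans ?_⟩
  simp

lemma markovOp_measurable {f : K → ℝ} (hf : Measurable f) : Measurable (S.markovOp f) :=
  Finset.measurable_fun_sum _ fun e _ => (S.p_measurable e).mul (hf.comp (S.w_measurable e))

lemma abs_markovOp_le {f : K → ℝ} {C : ℝ} (hf : ∀ y, |f y| ≤ C) (y : K) :
    |S.markovOp f y| ≤ C := by
  calc |S.markovOp f y| ≤ ∑ e, |S.p e y * f (S.w e y)| := Finset.abs_sum_le_sum_abs _ _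
    _ ≤ ∑ e, S.p e y * C := Finset.sum_le_sum fun e _ => by
        rw [abs_mul, abs_of_nonneg (S.p_nonneg e y)]
        exact mul_le_mul_of_nonneg_left (hf _) (S.p_nonneg e y)
    _ = C := by rw [← Finset.sum_mul, S.p_sum, one_mul]

lemma integrable_of_abs_le {μ : Measure K} [IsProbabilityMeasure μ] {f : K → ℝ}
    (hf : Measurable f) {C : ℝ} (hC : ∀ y, |f y| ≤ C) : Integrable f μ :=
  Integrable.of_bound hf.aestronglyMeasurable C (Eventually.of_forall hC)

/-- By the chain rule and invariance of `μ`, every letter contributes the same mean entropy. -/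
lemma integral_sum_negMulLog_pathProb (μ : Measure K) [IsProbabilityMeasure μ]
    (hμ : S.IsInvariant μ) (n : ℕ) :
    ∫ y, ∑ c : Fin n → E, Real.negMulLog (S.pathProb (List.ofFn c) y) ∂μ
      = n * ∫ y, S.localEntropy y ∂μ := by
  induction n with
  | zero => simp [pathProb]
  | succ n ih =>
    have hm : Measurable fun z =>
        ∑ c : Fin n → E, Real.negMulLog (S.pathProb (List.ofFn c) z) :=
      Finset.measurable_fun_sum _ fun c _ => S.measurable_negMulLog_pathProb _
    have hb := S.abs_sum_negMulLog_pathProb_le n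
    simp only [sum_negMulLog_pathProb_succ]
    rw [integral_add (integrable_of_abs_le S.measurable_localEntropy fun y => by
        rw [abs_of_nonneg (S.localEntropy_mem y).1]; exact (S.localEntropy_mem y).2)
      (integrable_of_abs_le (S.markovOp_measurable hm) (S.abs_markovOp_le hb)),
      hμ _ hm ⟨_, hb⟩, ih]
    push_cast; ring

/-- The expected value of `-log p_{e_n}(w_{e_{n-1}} ∘ ⋯ ∘ w_{e_0} z)` when the word is chosen
with the transition probabilities along the orbit of `y`. -/
noncomputable def crossCost : ℕ → K → K → ℝ
  | 0, y, z => ∑ e, S.p e y * -Real.log (S.p e z)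
  | n + 1, y, z => ∑ e, S.p e y * crossCost n (S.w e y) (S.w e z)

lemma crossCost_eq_sum (n : ℕ) (y z : K) :
    S.crossCost n y z = ∑ c : Fin (n + 1) → E,
      S.pathProb (List.ofFn c) y * -Real.log (S.lastProb n c z) := by
  induction n generalizing y z with
  | zero =>
    rw [sum_word_succ, crossCost]
    refine Finset.sum_congr rfl fun e _ => ?_
    simp [pathProb, lastProb]
  | succ n ih =>
    rw [sum_word_succ, crossCost]
    refine Finset.sum_congr rfl fun e _ => ?_
    simp only [pathProb_ofFn_cons, lastProb, Fin.tail_cons, Fin.cons_zero, ih, mul_assoc,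
      Finset.mul_sum]

lemma crossCost_diag_zero (y : K) : S.crossCost 0 y y = S.localEntropy y := by
  rw [crossCost, localEntropy]
  exact Finset.sum_congr rfl fun e _ => by rw [Real.negMulLog]; ring

/-- On the diagonal the recursion is the Markov operator applied to `localEntropy`, whose mean is
preserved by invariance. -/
lemma crossCost_diag_properties (μ : Measure K) [IsProbabilityMeasure μ] (hμ : S.IsInvariant μ)
    (n : ℕ) : Measurable (fun y => S.crossCost n y y)
      ∧ (∀ y, |S.crossCost n y y| ≤ Fintype.card E)
      ∧ ∫ y, S.crossCost n y y ∂μ = ∫ y, S.localEntropy y ∂μ := by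
  induction n with
  | zero =>
    simp only [crossCost_diag_zero]
    exact ⟨S.measurable_localEntropy, fun y => by
      rw [abs_of_nonneg (S.localEntropy_mem y).1]; exact (S.localEntropy_mem y).2, trivial⟩
  | succ n ih =>
    obtain ⟨h1, h2, h3⟩ := ih
    have hrec : (fun y => S.crossCost (n + 1) y y) = S.markovOp fun z => S.crossCost n z z := rfl
    refine ⟨hrec ▸ S.markovOp_measurable h1, fun y => S.abs_markovOp_le h2 y, ?_⟩
    rw [hrec, ← h3]
    exact hμ _ h1 ⟨_, h2⟩

/-- The costs along words, with the starting point determined by the first edge. -/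
lemma sum_pathProb_mul_log_eq_crossCost (x : V → K) (n : ℕ) {v : V} {y : K}
    (hy : y ∈ S.vertexSet v) :
    ∑ c : Fin (n + 1) → E,
        S.pathProb (List.ofFn c) y * -Real.log (S.lastProb n c (x (S.init (c 0))))
      = S.crossCost n y (x v) := by
  rw [crossCost_eq_sum, sum_word_succ, sum_word_succ]
  refine Finset.sum_congr rfl fun e _ => Finset.sum_congr rfl fun c _ => ?_
  rw [pathProb_ofFn_cons]
  -- A word whose first edge does not leave `v` has probability zero from `y`, so its base point is
  -- immaterial.
  by_cases he : S.init e = v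
  · simp [he]
  · rw [S.p_zero e y fun h => Set.disjoint_left.1 (S.vertexSet_disjoint he) h hy]
    simp

end WordSums

/-! ### Loss of dependence on the starting point. -/

section Contraction

variable {V E K : Type*} [Fintype E] [MetricSpace K] [MeasurableSpace K]
  {S : MarkovSystem V E K}
  (hunif : ∀ e, UniformContinuousOn (S.p e) (S.vertexSet (S.init e)))
  {δ : ℝ} (hδ : 0 < δ) (hp : ∀ e, ∀ y ∈ S.vertexSet (S.init e), δ ≤ S.p e y)
include hunif hδ hp

/-- For close points, uniform continuity with tolerance `ε * δ` and `log t ≤ t - 1` give the bound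
`ε`. At distance at least `η`, the crude bound `|log δ|` is absorbed by the linear term. A bound
affine in the distance is what contraction on average can iterate. -/
lemma exists_log_sub_log_le (e : E) {ε : ℝ} (hε : 0 < ε) :
    ∃ C, 0 ≤ C ∧ ∀ y ∈ S.vertexSet (S.init e), ∀ z ∈ S.vertexSet (S.init e),
      Real.log (S.p e y) - Real.log (S.p e z) ≤ ε + C * dist y z := by
  obtain ⟨η, hη, h⟩ := Metric.uniformContinuousOn_iff.1 (hunif e) (ε * δ) (mul_pos hε hδ)
  refine ⟨|Real.log δ| / η, by positivity, fun y hy z hz => ?_⟩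
  have hpy := hδ.trans_le (hp e y hy)
  have hpz := hδ.trans_le (hp e z hz)
  rcases lt_or_ge (dist y z) η with hd | hd
  · have h1 := h y hy z hz hd
    rw [Real.dist_eq] at h1
    have h2 : Real.log (S.p e y) - Real.log (S.p e z) ≤ ε := by
      rw [← Real.log_div hpy.ne' hpz.ne']
      refine (Real.log_le_sub_one_of_pos (div_pos hpy hpz)).trans ?_
      rw [sub_le_iff_le_add, div_le_iff₀ hpz]
      nlinarith [le_abs_self (S.p e y - S.p e z), hp e z hz]
    have h3 : 0 ≤ |Real.log δ| / η * dist y z := by positivity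
    linarith
  · have h1 := Real.log_nonpos hpy.le (S.p_le_one e y)
    have h2 := Real.log_le_log hδ (hp e z hz)
    have h3 : |Real.log δ| ≤ |Real.log δ| / η * dist y z := by
      rw [div_mul_eq_mul_div, le_div_iff₀ hη]
      exact mul_le_mul_of_nonneg_left hd (abs_nonneg _)
    linarith [neg_abs_le (Real.log δ)]

/-- Each step averages with weights of total mass one, so `ε` does not accumulate, while the mean
distance shrinks by the factor `a`. The constant is independent of `n`. -/
lemma exists_crossCost_le {a : ℝ} (ha : S.IsContractive a) {ε : ℝ} (hε : 0 < ε) :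
    ∃ C, 0 ≤ C ∧ ∀ (n : ℕ) (v : V), ∀ y ∈ S.vertexSet v, ∀ z ∈ S.vertexSet v,
      S.crossCost n y z ≤ S.crossCost n y y + ε + C * a ^ n * dist y z := by
  choose C hC0 hC using fun e => exists_log_sub_log_le hunif hδ hp e hε
  have hsum : 0 ≤ ∑ e, C e := Finset.sum_nonneg fun e _ => hC0 e
  refine ⟨∑ e, C e, hsum, fun n => ?_⟩
  have hmem : ∀ {v : V} {y z : K} {e : E}, y ∈ S.vertexSet v → z ∈ S.vertexSet v →
      S.p e y ≠ 0 → y ∈ S.vertexSet (S.init e) ∧ z ∈ S.vertexSet (S.init e) := by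
    intro v y z e hy hz he
    have h1 : y ∈ S.vertexSet (S.init e) := by
      by_contra h
      exact he (S.p_zero e y h)
    have h2 : v = S.init e := by
      by_contra h
      exact Set.disjoint_left.1 (S.vertexSet_disjoint h) hy h1
    exact ⟨h1, h2 ▸ hz⟩
  induction n with
  | zero =>
    intro v y hy z hz
    calc S.crossCost 0 y z
        ≤ ∑ e, (S.p e y * -Real.log (S.p e y)
            + S.p e y * (ε + (∑ e, C e) * dist y z)) := by
          refine Finset.sum_le_sum fun e _ => ?_
          by_cases he : S.p e y = 0
          · simp [he]
          · obtain ⟨h1, h2⟩ := hmem hy hz he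
            rw [← mul_add]
            refine mul_le_mul_of_nonneg_left ?_ (S.p_nonneg e y)
            have h3 := hC e y h1 z h2
            have h4 : C e * dist y z ≤ (∑ e, C e) * dist y z :=
              mul_le_mul_of_nonneg_right
                (Finset.single_le_sum (fun i _ => hC0 i) (Finset.mem_univ e)) dist_nonneg
            linarith
      _ = _ := by
          rw [Finset.sum_add_distrib, ← Finset.sum_mul, S.p_sum, crossCost]
          ring
  | succ n ih =>
    intro v y hy z hz
    calc S.crossCost (n + 1) y z
        ≤ ∑ e, (S.p e y * S.crossCost n (S.w e y) (S.w e y) + S.p e y * ε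
            + (∑ e, C e) * a ^ n * (S.p e y * dist (S.w e y) (S.w e z))) := by
          refine Finset.sum_le_sum fun e _ => ?_
          -- Edges of weight zero are set aside, since `w_e` is controlled only on its own vertex
          -- set.
          by_cases he : S.p e y = 0
          · simp [he]
          · obtain ⟨h1, h2⟩ := hmem hy hz he
            have h3 := mul_le_mul_of_nonneg_left
              (ih _ _ (S.w_mapsTo e h1) _ (S.w_mapsTo e h2)) (S.p_nonneg e y)
            linarith
      _ = S.crossCost (n + 1) y y + ε
            + (∑ e, C e) * a ^ n * ∑ e, S.p e y * dist (S.w e y) (S.w e z) := by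
          rw [Finset.sum_add_distrib, Finset.sum_add_distrib, ← Finset.sum_mul, S.p_sum,
            ← Finset.mul_sum, crossCost]
          ring
      _ ≤ S.crossCost (n + 1) y y + ε + (∑ e, C e) * a ^ n * (a * dist y z) := by
          gcongr
          · exact mul_nonneg hsum (pow_nonneg ha.1.le n)
          · exact ha.2.2 v y hy z hz
      _ = _ := by rw [pow_succ]; ring

end Contraction

/-! ### Entropy and energy of the generalized Markov measure. -/

section MarkovMeasure

variable {V E K : Type*} [Fintype V] [Fintype E]
  [TopologicalSpace E] [DiscreteTopology E] [MeasurableSpace E] [BorelSpace E]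
  [MetricSpace K] [ProperSpace K] [MeasurableSpace K] [BorelSpace K]
  {S : MarkovSystem V E K} {μ : Measure K} [IsProbabilityMeasure μ]

lemma codeWindow_preimage_singleton (m : ℤ) (n : ℕ) (c : Fin n → E) :
    codeWindow m n ⁻¹' {c} = cylinderSet m (List.ofFn c) := by
  ext σ
  simp only [Set.mem_preimage, Set.mem_singleton_iff, cylinderSet, Set.mem_ofPred_eq]
  constructor
  · rintro rfl j
    rw [List.get_ofFn]
    rfl
  · intro hc
    funext j
    have := hc ⟨j, by rw [List.length_ofFn]; exact j.2⟩
    rw [List.get_ofFn] at this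
    exact this

variable (hμ : S.IsInvariant μ)

lemma isProbabilityMeasure_markovMeasure : IsProbabilityMeasure (S.markovMeasure μ hμ) := by
  have h := S.markovMeasure_cylinder μ hμ 0 []
  have hu : cylinderSet (0 : ℤ) ([] : List E) = Set.univ := by ext σ; simp [cylinderSet]
  rw [hu] at h
  exact ⟨by simpa [pathProb] using h⟩

lemma markovMeasure_real_codeWindow (m : ℤ) (n : ℕ) (c : Fin n → E) :
    (S.markovMeasure μ hμ).real (codeWindow m n ⁻¹' {c})
      = ∫ y, S.pathProb (List.ofFn c) y ∂μ := by
  rw [codeWindow_preimage_singleton, measureReal_def, S.markovMeasure_cylinder μ hμ,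
    ENNReal.toReal_ofReal (integral_nonneg fun y => (S.pathProb_mem _ y).1)]

/-- The cylinder values do not depend on the position `m`, and they determine the measure. -/
lemma measurePreserving_markovMeasure :
    MeasurePreserving leftShift (S.markovMeasure μ hμ) (S.markovMeasure μ hμ) := by
  refine ⟨measurable_leftShift, S.markovCylinders_unique μ _ _ (fun m l => ?_)
    (S.markovMeasure_cylinder μ hμ)⟩
  rw [Measure.map_apply measurable_leftShift (cylinder_isClopen m l).isOpen.measurableSet,
    ← S.markovMeasure_cylinder μ hμ (m + 1) l]
  congr 1
  ext σ
  simp only [cylinderSet, leftShift, Set.mem_preimage, Set.mem_ofPred_eq]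
  refine forall_congr' fun j => ?_
  rw [add_right_comm]

/-- The Jensen inequality for the entropy of words. -/
lemma mul_integral_localEntropy_le_finEntropy (n : ℕ) :
    n * ∫ y, S.localEntropy y ∂μ ≤ finEntropy (S.markovMeasure μ hμ) (codeWindow 0 n) := by
  have hint : ∀ c : Fin n → E,
      Integrable (fun y => Real.negMulLog (S.pathProb (List.ofFn c) y)) μ := fun c =>
    integrable_of_abs_le (S.measurable_negMulLog_pathProb _) (C := 1) fun y => by
      have h := negMulLog_mem_Icc (S.pathProb_mem (List.ofFn c) y).1
        (S.pathProb_mem (List.ofFn c) y).2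
      rw [abs_of_nonneg h.1]; exact h.2
  rw [← S.integral_sum_negMulLog_pathProb μ hμ, integral_finsetSum _ fun c _ => hint c]
  refine Finset.sum_le_sum fun c _ => ?_
  rw [markovMeasure_real_codeWindow]
  exact Real.concaveOn_negMulLog.le_map_integral Real.continuous_negMulLog.continuousOn
    isClosed_Ici (Eventually.of_forall fun y => (S.pathProb_mem _ y).1)
    (S.pathProb_integrable μ _) (hint c)

/-- The partition by the letter `σ_0` suffices: its `n`-fold join determines the word of length `n`.
-/
lemma integral_localEntropy_le_ksEntropy :
    ((∫ y, S.localEntropy y ∂μ : ℝ) : EReal) ≤ ksEntropy leftShift (S.markovMeasure μ hμ) := by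
  have := isProbabilityMeasure_markovMeasure hμ
  let P : CodeSpace E → Fin (Fintype.card E) := fun σ => Fintype.equivFin E (σ 0)
  have hP : Measurable P := (measurable_of_finite _).comp (measurable_pi_apply 0)
  have hle : partitionEntropy leftShift (S.markovMeasure μ hμ) P
      ≤ ksEntropy leftShift (S.markovMeasure μ hμ) :=
    le_iSup_of_le _ (le_iSup_of_le P (le_iSup_of_le hP le_rfl))
  refine le_trans ?_ hle
  refine le_limsup_of_frequently_le (Eventually.frequently ?_) ⟨⊤, by simp⟩
  filter_upwards [eventually_gt_atTop 0] with n hn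
  have hn' : (0 : ℝ) < n := by exact_mod_cast hn
  rw [EReal.coe_le_coe_iff, le_div_iff₀ hn', mul_comm]
  refine (mul_integral_localEntropy_le_finEntropy hμ n).trans ?_
  rw [joinEntropy_eq_finEntropy]
  refine finEntropy_le_of_factors _ (measurable_pi_lambda _ fun i =>
    hP.comp (measurable_leftShift.iterate _)) fun σ τ h => ?_
  funext i
  have hi := congrFun h i
  simp only [P, EmbeddingLike.apply_eq_iff_eq, leftShift_iterate_apply] at hi
  exact hi

/-- The integrand depends only on `σ_{-n}, …, σ_1`. In the cylinder formula `y` is the state before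
`σ_{-n}` is read. -/
lemma integral_log_backOrbit_eq (x : V → K) (n : ℕ) :
    ∫ σ, -Real.log (S.p (σ 1) (S.backOrbit x σ n)) ∂(S.markovMeasure μ hμ)
      = ∫ y, ∑ c : Fin (n + 2) → E, S.pathProb (List.ofFn c) y
          * -Real.log (S.lastProb (n + 1) c (x (S.init (c 0)))) ∂μ := by
  have := isProbabilityMeasure_markovMeasure hμ
  have h := integral_comp_finite (S.markovMeasure μ hμ) (measurable_codeWindow (-n) (n + 2))
    (fun c => -Real.log (S.lastProb (n + 1) c (x (S.init (c 0)))))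
  rw [integral_finsetSum _ fun c _ => (S.pathProb_integrable μ _).mul_const _]
  simp only [integral_mul_const]
  simp only [markovMeasure_real_codeWindow] at h
  rw [← h]
  refine integral_congr_ae (Eventually.of_forall fun σ => ?_)
  simp only [lastProb_codeWindow, backOrbit]
  simp [codeWindow]

/-- The distance to the chosen point in the same vertex set. -/
noncomputable def distToBase (S : MarkovSystem V E K) (x : V → K) (y : K) : ℝ :=
  ∑ v, (S.vertexSet v).indicator (fun y => dist y (x v)) y

lemma distToBase_eq (x : V → K) {v : V} {y : K} (hy : y ∈ S.vertexSet v) :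
    S.distToBase x y = dist y (x v) := by
  rw [distToBase, Finset.sum_eq_single v, Set.indicator_of_mem hy]
  · intro v' _ hv'
    exact Set.indicator_of_notMem
      (fun h => Set.disjoint_left.1 (S.vertexSet_disjoint hv') h hy) _
  · simp

omit [IsProbabilityMeasure μ] in
-- By the triangle inequality, the moment condition does not depend on the choice of reference
-- points.
lemma integrable_distToBase [IsFiniteMeasure μ] (x : V → K)
    (hmoment : ∃ z : V → K, (∑ v, (∫⁻ y in S.vertexSet v, edist y (z v) ∂μ)) < ⊤) :
    Integrable (S.distToBase x) μ := by
  obtain ⟨z, hz⟩ := hmoment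
  refine integrable_finsetSum _ fun v _ => ?_
  rw [integrable_indicator_iff (S.vertexSet_measurable v)]
  have h1 : IntegrableOn (fun y => dist y (z v)) (S.vertexSet v) μ := by
    refine ⟨(measurable_id.dist measurable_const).aestronglyMeasurable, ?_⟩
    rw [HasFiniteIntegral]
    refine lt_of_eq_of_lt ?_ ((ENNReal.sum_lt_top.1 hz) v (Finset.mem_univ v))
    refine lintegral_congr fun y => ?_
    rw [Real.enorm_eq_ofReal dist_nonneg, edist_dist]
  refine Integrable.mono' (h1.add (integrableOn_const (C := dist (z v) (x v))))
    (measurable_id.dist measurable_const).aestronglyMeasurable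
    (Eventually.of_forall fun y => ?_)
  rw [Real.norm_eq_abs, abs_of_nonneg dist_nonneg]
  exact dist_triangle _ _ _

variable {x : V → K} (hopen : ∀ v, IsOpen (S.vertexSet v)) {a : ℝ} (ha : S.IsContractive a)
  (hunif : ∀ e, UniformContinuousOn (S.p e) (S.vertexSet (S.init e)))
  {δ : ℝ} (hδ : 0 < δ) (hp : ∀ e, ∀ y ∈ S.vertexSet (S.init e), δ ≤ S.p e y)
  (hx : ∀ v, x v ∈ S.vertexSet v)
  (hmoment : ∃ z : V → K, (∑ v, (∫⁻ y in S.vertexSet v, edist y (z v) ∂μ)) < ⊤)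
  (hY : ∀ᵐ σ ∂(S.markovMeasure μ hμ), σ ∈ S.codingDomain x)
include hopen ha hunif hδ hp hx hmoment hY

/-- The left side is the limit of prediction costs started from base points in the remote past. Each
is at most the mean diagonal cost plus `ε` and a multiple of `a ^ (n + 1)`; then `n → ∞` and `ε →
0`. -/
lemma integral_log_codingMap_le :
    ∫ σ, -Real.log (S.p (σ 1) (S.codingMap x σ)) ∂(S.markovMeasure μ hμ)
      ≤ ∫ y, S.localEntropy y ∂μ := by
  have := isProbabilityMeasure_markovMeasure hμ
  refine le_of_forall_pos_le_add fun ε hε => ?_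
  obtain ⟨C, hC0, hC⟩ := exists_crossCost_le hunif hδ hp ha hε
  have hbase := integrable_distToBase (μ := μ) (S := S) x hmoment
  have hbound : ∀ n : ℕ, ∫ σ, -Real.log (S.p (σ 1) (S.backOrbit x σ n)) ∂(S.markovMeasure μ hμ)
      ≤ ∫ y, S.localEntropy y ∂μ + ε + C * a ^ (n + 1) * ∫ y, S.distToBase x y ∂μ := by
    intro n
    obtain ⟨h1, h2, h3⟩ := S.crossCost_diag_properties μ hμ (n + 1)
    have hdiag : Integrable (fun y => S.crossCost (n + 1) y y) μ := integrable_of_abs_le h1 h2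
    have hadd : Integrable (fun y => S.crossCost (n + 1) y y + ε) μ :=
      hdiag.add (integrable_const ε)
    rw [integral_log_backOrbit_eq hμ, ← h3]
    calc _ ≤ ∫ y, (S.crossCost (n + 1) y y + ε + C * a ^ (n + 1) * S.distToBase x y) ∂μ := by
          refine integral_mono
            (integrable_finsetSum _ fun c _ => (S.pathProb_integrable μ _).mul_const _)
            (hadd.add (hbase.const_mul _)) fun y => ?_
          obtain ⟨v, hv⟩ := Set.mem_iUnion.1 (S.vertexSet_cover.symm ▸ Set.mem_univ y)
          simp only [S.sum_pathProb_mul_log_eq_crossCost x (n + 1) hv, distToBase_eq x hv]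
          exact hC (n + 1) v y hv (x v) (hx v)
      _ = _ := by
          rw [integral_add hadd (hbase.const_mul _),
            integral_add hdiag (integrable_const ε), integral_const_mul]
          simp
  have hlim : Tendsto (fun n : ℕ => ∫ y, S.localEntropy y ∂μ + ε
      + C * a ^ (n + 1) * ∫ y, S.distToBase x y ∂μ) atTop
      (𝓝 (∫ y, S.localEntropy y ∂μ + ε + C * 0 * ∫ y, S.distToBase x y ∂μ)) :=
    tendsto_const_nhds.add (((tendsto_pow_atTop_nhds_zero_of_lt_one ha.1.le ha.2.1).comp
      (tendsto_add_atTop_nat 1)).const_mul C |>.mul_const _)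
  have h := le_of_tendsto_of_tendsto'
    (tendsto_integral_log_backOrbit hopen hunif hδ hp hx hY) hlim hbound
  simpa using h

theorem zero_le_ksEntropy_add_energyIntegral :
    0 ≤ ksEntropy leftShift (S.markovMeasure μ hμ)
      + energyIntegral (S.markovMeasure μ hμ) (S.energy x) := by
  have := isProbabilityMeasure_markovMeasure hμ
  rw [energyIntegral_energy_eq hopen hunif hδ hp hx hY]
  have h1 := EReal.coe_le_coe_iff.2
    (integral_log_codingMap_le hμ hopen ha hunif hδ hp hx hmoment hY)
  refine le_trans (le_of_eq ?_)
    (add_le_add_left (h1.trans (integral_localEntropy_le_ksEntropy hμ)) _)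
  rw [← EReal.coe_add, add_neg_cancel, EReal.coe_zero]

end MarkovMeasure

end MarkovSystem

/-! ### The two inequalities combined. -/

theorem proposition1
    {V E K : Type*} [Fintype V] [Fintype E]
    [TopologicalSpace E] [DiscreteTopology E] [MeasurableSpace E] [BorelSpace E]
    [MetricSpace K] [ProperSpace K] [MeasurableSpace K] [BorelSpace K]
    (S : MarkovSystem V E K)
    (hinit : Function.Surjective S.init)
    (hopen : ∀ v, IsOpen (S.vertexSet v))
    (a : ℝ) (ha : S.IsContractive a)
    (hunif : ∀ e, UniformContinuousOn (S.p e) (S.vertexSet (S.init e)))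
    (δ : ℝ) (hδ : 0 < δ) (hp : ∀ e, ∀ y ∈ S.vertexSet (S.init e), δ ≤ S.p e y)
    (x : V → K) (hx : ∀ v, x v ∈ S.vertexSet v)
    (μ : Measure K) [IsProbabilityMeasure μ] (hμ : S.IsInvariant μ)
    (hmoment : ∃ z : V → K, (∑ v, (∫⁻ y in S.vertexSet v, edist y (z v) ∂μ)) < ⊤)
    (hY : S.markovMeasure μ hμ (S.codingDomain x) = 1) :
    IsEquilibriumState leftShift (S.energy x) (S.markovMeasure μ hμ) ∧
      pressure (X := CodeSpace E) leftShift (S.energy x) = 0 := by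
  have hprob := MarkovSystem.isProbabilityMeasure_markovMeasure hμ
  have hinv := MarkovSystem.measurePreserving_markovMeasure hμ
  have hae : ∀ᵐ σ ∂(S.markovMeasure μ hμ), σ ∈ S.codingDomain x :=
    (prob_compl_eq_zero_iff MarkovSystem.measurableSet_codingDomain).2 hY
  have hup : ∀ Θ ∈ invariantMeasures (leftShift : CodeSpace E → CodeSpace E),
      ksEntropy leftShift Θ + energyIntegral Θ (S.energy x) ≤ 0 := by
    rintro Θ ⟨hΘp, hΘ⟩
    exact MarkovSystem.ksEntropy_add_energyIntegral_le_zero hopen hunif hδ hp hx hΘ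
  have hlow := MarkovSystem.zero_le_ksEntropy_add_energyIntegral hμ hopen ha hunif hδ hp hx
    hmoment hae
  have hM : S.markovMeasure μ hμ ∈ invariantMeasures leftShift := ⟨hprob, hinv⟩
  have hzero : ksEntropy leftShift (S.markovMeasure μ hμ)
      + energyIntegral (S.markovMeasure μ hμ) (S.energy x) = 0 := (hup _ hM).antisymm hlow
  have hpress : pressure (X := CodeSpace E) leftShift (S.energy x) = 0 :=
    (iSup₂_le hup).antisymm (hlow.trans (le_iSup₂_of_le _ hM le_rfl))
  refine ⟨⟨MarkovSystem.isEnergyFunction_energy hopen hunif hδ hp hx, ?_, hM,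
    hzero.trans hpress.symm⟩, hpress⟩
  -- Finite topological entropy: the full shift has entropy at most `log |E|`.
  refine (iSup₂_le (a := (Real.log (Fintype.card E) : EReal)) ?_).trans_lt (EReal.coe_lt_top _)
  rintro Θ ⟨hΘp, hΘ⟩
  exact ksEntropy_leftShift_le_log_card hΘ
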